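/- Let $(\mathbf X,\mathscr B(\mathbf X))$ be a complete separable metric space with its Borel $\sigma$-algebra, and let $d\in\mathbb N$. Assume the following. (A1) $\{X_s\}_{s\ge0}$ is a time-homogeneous Markov family on $\mathbf X$, with laws $\mathbf P_x$ ($x\in\mathbf X$, $X_0=x$ $\mathbf P_x$-a.s.) and transition function $P(s,x,\Gamma)=\mathbf P_x(X_s\in\Gamma)$, whose sample paths are càdlàg, i.e. lie in the Skorokhod space $D([0,\infty),\mathbf X)$. (A2) $\nu$ is the unique invariant probability measure of $\{X_s\}$, and there is $\mathcal T>0$ with $\sup_{x\in\mathbf X}\mathrm{TV}(P(\mathcal T,x,\cdot),\nu)<1$, where $\mathrm{TV}(\mu,\mu')=\sup_A|\mu(A)-\mu'(A)|$. (A3) $b:[0,1]\times\mathbf X\to\mathbb R^d$ is continuous and bounded; $\int_{\mathbf X}b(\alpha,\cdot)\,d\nu=0$ for each $\alpha\in[0,1]$; and $b$ is twice differentiable in $\alpha$, with $\partial_\alpha b$ and $\partial_\alpha^2 b$ continuous and bounded on $[0,1]\times\mathbf X$. Let $\mathcal B$ be the Banach space of bounded measurable functions $f:\mathbf X\to\mathbb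 C$ with the supremum norm, and for $t\in\mathbb R^d$, $\alpha,\beta\in[0,1]$ let $Q(t,\alpha,\beta)$ be the bounded operator on $\mathcal B$ $$Q(t,\alpha,\beta)f(x)=\mathbf E_x\Big[\exp\Big(it\cdot\int_0^1 b(\alpha+s(\beta-\alpha),X_s)\,ds\Big)f(X_1)\Big].$$ Write $r(\cdot)$ for the spectral radius. Then the following two conditions are equivalent. (A4) (non-arithmetic condition) For every $\alpha\in[0,1]$ and every $t\in\mathbb R^d\setminus\{0\}$, $r(Q(t,\alpha,\alpha))<1$. (NL) (non-lattice condition) For every $\alpha\in[0,1]$ there are no $a\in\mathbb R^d$, closed subgroup $H\subsetneq\mathbb R^d$, and bounded measurable $u:\mathbf X\to\mathbb R^d$ such that $$\int_0^1 b(\alpha,X_s)\,ds+u(X_1)-u(X_0)\in a+H$$ almost surely for the process started from the initial distribution $\nu$. -/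

import Mathlib

open MeasureTheory ProbabilityTheory Set Filter Topology
open scoped NNReal ENNReal BoundedContinuousFunction

noncomputable section

namespace NonLattice

/-- The Euclidean space `ℝ^d`. -/
abbrev Vec (d : ℕ) : Type := EuclideanSpace ℝ (Fin d)

/-! ### The Banach space of bounded measurable functions -/

/-- The bounded measurable complex functions on `E`, as a subspace of the space `ℓ^∞(E)` of all
bounded complex functions with the supremum norm. -/
def boundedMeasurable (E : Type*) [MeasurableSpace E] :
    Submodule ℂ (lp (fun _ : E => ℂ) ∞) where
  carrier := {f | Measurable (f : E → ℂ)}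
  add_mem' {f g} hf hg := by
    have h : Measurable ((f : E → ℂ) + (g : E → ℂ)) := Measurable.add hf hg
    simpa only [mem_ofPred_eq, lp.coeFn_add] using h
  zero_mem' := by
    have h : Measurable (0 : E → ℂ) := measurable_zero
    simpa only [mem_ofPred_eq, lp.coeFn_zero] using h
  smul_mem' c f hf := by
    have h : Measurable (c • (f : E → ℂ)) := Measurable.const_smul hf c
    simpa only [mem_ofPred_eq, lp.coeFn_smul] using h

/-- The normed space of bounded measurable complex functions with the supremum norm. -/
abbrev BM (E : Type*) [MeasurableSpace E] : Type _ := ↥(boundedMeasurable E)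

/-- The function underlying an element of `BM E`. -/
def BM.toFun {E : Type*} [MeasurableSpace E] (f : BM E) : E → ℂ := (f : lp (fun _ : E => ℂ) ∞)

theorem BM.measurable {E : Type*} [MeasurableSpace E] (f : BM E) : Measurable f.toFun := f.2

theorem BM.norm_apply_le {E : Type*} [MeasurableSpace E] (f : BM E) (x : E) :
    ‖f.toFun x‖ ≤ ‖f‖ :=
  lp.norm_apply_le_norm (by simp) (f : lp (fun _ : E => ℂ) ∞) x

/-- A bounded measurable function, as an element of `BM E`. -/
def BM.mk {E : Type*} [MeasurableSpace E] (f : E → ℂ) (hf : Measurable f) (C : ℝ)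
    (hC : ∀ x, ‖f x‖ ≤ C) : BM E :=
  ⟨⟨f, memℓp_infty ⟨C, by rintro _ ⟨x, rfl⟩; exact hC x⟩⟩, hf⟩

/-- `BM E` is a Banach space. -/
instance BM.completeSpace (E : Type*) [MeasurableSpace E] : CompleteSpace (BM E) := by
  have hc : IsClosed (boundedMeasurable E : Set (lp (fun _ : E => ℂ) ∞)) := by
    refine isClosed_of_closure_subset fun f hf => ?_
    obtain ⟨u, hu, hlim⟩ := mem_closure_iff_seq_limit.1 hf
    have hev : ∀ x : E, Tendsto (fun n => (u n : E → ℂ) x) atTop (𝓝 ((f : E → ℂ) x)) := by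
      intro x
      rw [tendsto_iff_norm_sub_tendsto_zero] at hlim ⊢
      refine squeeze_zero (fun _ => norm_nonneg _) (fun n => ?_) hlim
      have := lp.norm_apply_le_norm (p := ∞) (by simp) (u n - f) x
      simpa using this
    exact measurable_of_tendsto_metrizable hu (tendsto_pi_nhds.2 hev)
  exact hc.completeSpace_coe

/-! ### Markov families with càdlàg paths -/

/-- A path `[0,∞) → E` is càdlàg: right continuous with left limits. -/
def IsCadlag {E : Type*} [TopologicalSpace E] (w : ℝ≥0 → E) : Prop :=
  ∀ s, ContinuousWithinAt w (Ici s) s ∧ ∃ l, Tendsto w (𝓝[<] s) (𝓝 l)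

/-- A time-homogeneous Markov family on `E` with càdlàg paths, realized on the measurable space
`Ω`: the process `X`, and for each `x : E` the law `law x` under which `X` starts at `x`. -/
structure MarkovFamily (E Ω : Type*) [TopologicalSpace E] [MeasurableSpace E]
    [MeasurableSpace Ω] where
  /-- the process -/
  X : ℝ≥0 → Ω → E
  /-- the probability measures `P_x`, measurable in the starting point `x` -/
  law : Kernel E Ω
  isMarkov : IsMarkovKernel law
  measurable_X : ∀ s, Measurable (X s)
  cadlag : ∀ ω, IsCadlag fun s => X s ω
  start : ∀ x, ∀ᵐ ω ∂(law x), X 0 ω = x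
  /-- the Markov property `P_x(X_{s+t} ∈ Γ | X_r, r ≤ s) = P(t, X_s, Γ)`, where
  `P(t, y, Γ) = P_y(X_t ∈ Γ)` -/
  markov : ∀ (x : E) (s t : ℝ≥0) (Γ : Set E), MeasurableSet Γ →
    condExp (⨆ r ∈ Iic s, MeasurableSpace.comap (X r) inferInstance) (law x)
        ((X (s + t) ⁻¹' Γ).indicator fun _ => (1 : ℝ))
      =ᵐ[law x] fun ω => (law (X s ω)).real (X t ⁻¹' Γ)

namespace MarkovFamily

variable {E Ω : Type*} [MeasurableSpace Ω]

/-- The transition function `P(s, x, Γ) = P_x(X_s ∈ Γ)`. -/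
def transition [TopologicalSpace E] [MeasurableSpace E] (M : MarkovFamily E Ω) (s : ℝ≥0) :
    Kernel E E :=
  M.law.map (M.X s)

/-- The law `P_ν` of the process with initial distribution `ν`. -/
def lawFrom [TopologicalSpace E] [MeasurableSpace E] (M : MarkovFamily E Ω) (ν : Measure E) :
    Measure Ω :=
  ν.bind M.law

/-- `ν` is an invariant probability measure of the family. -/
def IsInvariant [TopologicalSpace E] [MeasurableSpace E] (M : MarkovFamily E Ω)
    (ν : Measure E) : Prop :=
  IsProbabilityMeasure ν ∧ ∀ s, (M.transition s).Invariant ν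

end MarkovFamily

/-- The total variation distance `sup_A |μ(A) - ν(A)|` of two probability measures. -/
def tvDist {E : Type*} [MeasurableSpace E] (μ ν : Measure E) : ℝ :=
  ⨆ A : {A : Set E // MeasurableSet A}, |μ.real A - ν.real A|

/-- `ν` is the unique invariant probability measure, and at some time `T > 0` the transition
probabilities are at total variation distance from `ν` bounded away from `1`, uniformly in the
starting point. -/
def Mixing {E Ω : Type*} [TopologicalSpace E] [MeasurableSpace E] [MeasurableSpace Ω]
    (M : MarkovFamily E Ω) (ν : Measure E) : Prop :=
  (M.IsInvariant ν ∧ ∀ ν', M.IsInvariant ν' → ν' = ν) ∧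
    ∃ T : ℝ≥0, 0 < T ∧ (⨆ x, tvDist (M.transition T x) ν) < 1

/-! ### The function `b` -/

/-- `b₁(α, x)` is the derivative in `α` of `b(α, x)`, for all `α ∈ [0,1]` (one-sided at the end
points) and all `x`. -/
def HasParamDeriv {E : Type*} [TopologicalSpace E] {d : ℕ}
    (b b₁ : (unitInterval × E) →ᵇ Vec d) : Prop :=
  ∀ (x : E) (α : unitInterval),
    HasDerivWithinAt (fun a : ℝ => b (projIcc 0 1 zero_le_one a, x)) (b₁ (α, x)) (Icc 0 1) α

/-- The assumptions on the bounded continuous function `b : [0,1] × E → ℝ^d`: it is centered with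
respect to `ν`, and it is twice differentiable in the first variable with both derivatives bounded
and continuous on `[0,1] × E`. -/
def CenteredSmooth {E : Type*} [TopologicalSpace E] [MeasurableSpace E] {d : ℕ}
    (ν : Measure E) (b : (unitInterval × E) →ᵇ Vec d) : Prop :=
  (∀ α, ∫ x, b (α, x) ∂ν = 0) ∧
    ∃ b₁ b₂ : (unitInterval × E) →ᵇ Vec d, HasParamDeriv b b₁ ∧ HasParamDeriv b₁ b₂

/-! ### The Fourier operators -/

section Fourier

variable {E Ω : Type*} [MetricSpace E] [MeasurableSpace E] [BorelSpace E] [MeasurableSpace Ω]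
  {d : ℕ}

/-- `∫_0^1 b(α + s (β - α), X_s) ds`. For `α, β ∈ [0,1]` the projection onto `[0,1]` only serves to
record that `α + s (β - α)` lies in `[0,1]`. -/
def pathIntegral (M : MarkovFamily E Ω) (b : (unitInterval × E) →ᵇ Vec d) (α β : unitInterval)
    (ω : Ω) : Vec d :=
  ∫ s in (0 : ℝ)..1,
    b (projIcc 0 1 zero_le_one ((α : ℝ) + s * ((β : ℝ) - α)), M.X s.toNNReal ω)

theorem measurable_X_discrete {E Ω : Type*} [TopologicalSpace E] [MeasurableSpace E]
    [MeasurableSpace Ω] (M : MarkovFamily E Ω) (c : ℕ → ℝ≥0) (k : ℝ≥0 → ℕ) (hk : Measurable k) :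
    Measurable fun p : ℝ≥0 × Ω => M.X (c (k p.1)) p.2 := by
  have h1 : Measurable fun q : ℕ × Ω => M.X (c q.1) q.2 :=
    measurable_from_prod_countable_right fun j => M.measurable_X (c j)
  exact h1.comp ((hk.comp measurable_fst).prodMk measurable_snd)

theorem measurable_uncurry_X (M : MarkovFamily E Ω) :
    Measurable fun p : ℝ≥0 × Ω => M.X p.1 p.2 := by
  let a : ℕ → ℝ≥0 → ℝ≥0 := fun n s => ((⌊(n + 1 : ℝ≥0) * s⌋₊ : ℝ≥0) + 1) / (n + 1)
  have hpos : ∀ n : ℕ, (0 : ℝ≥0) < n + 1 := fun n => by positivity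
  have hge : ∀ n s, s ≤ a n s := fun n s => by
    rw [le_div_iff₀ (hpos n), mul_comm]
    exact (Nat.lt_floor_add_one _).le
  have hle : ∀ n s, a n s ≤ s + 1 / (n + 1) := fun n s => by
    have h1 : ((⌊(n + 1 : ℝ≥0) * s⌋₊ : ℝ≥0)) ≤ (n + 1) * s := Nat.floor_le zero_le
    have h2 : (s + 1 / ((n : ℝ≥0) + 1)) * (n + 1) = (n + 1) * s + 1 := by
      rw [add_mul s, div_mul_cancel₀ _ (hpos n).ne', mul_comm s]
    rw [div_le_iff₀ (hpos n), h2]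
    gcongr
  have ha : ∀ s, Tendsto (fun n => a n s) atTop (𝓝[≥] s) := fun s => by
    refine tendsto_nhdsWithin_iff.2 ⟨?_, Eventually.of_forall fun n => hge n s⟩
    refine tendsto_of_tendsto_of_tendsto_of_le_of_le tendsto_const_nhds ?_
      (fun n => hge n s) (fun n => hle n s)
    have h0 : Tendsto (fun n : ℕ => (1 : ℝ≥0) / (n + 1)) atTop (𝓝 0) :=
      tendsto_one_div_add_atTop_nhds_zero_nat
    simpa using h0.const_add s
  refine measurable_of_tendsto_metrizable (f := fun (n : ℕ) (p : ℝ≥0 × Ω) => M.X (a n p.1) p.2)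
    (fun n => ?_) (tendsto_pi_nhds.2 fun p => ?_)
  · exact measurable_X_discrete M (fun k => ((k : ℝ≥0) + 1) / (n + 1))
      (fun s => ⌊(n + 1 : ℝ≥0) * s⌋₊) (Nat.measurable_floor.comp (measurable_id.const_mul _))
  · exact ((M.cadlag p.2 p.1).1.tendsto).comp (ha p.1)

theorem measurable_pathIntegral (M : MarkovFamily E Ω) (b : (unitInterval × E) →ᵇ Vec d)
    (α β : unitInterval) : Measurable (pathIntegral M b α β) := by
  have h1 : Measurable fun p : Ω × ℝ =>
      b (projIcc 0 1 zero_le_one ((α : ℝ) + p.2 * ((β : ℝ) - α)), M.X p.2.toNNReal p.1) := by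
    refine b.continuous.measurable.comp (Measurable.prodMk ?_ ?_)
    · exact continuous_projIcc.measurable.comp
        ((measurable_snd.mul_const _).const_add _)
    · exact (measurable_uncurry_X M).comp
        ((measurable_real_toNNReal.comp measurable_snd).prodMk measurable_fst)
  unfold pathIntegral
  simp only [intervalIntegral.integral_of_le zero_le_one]
  exact (h1.stronglyMeasurable.integral_prod_right' (ν := volume.restrict (Ioc (0 : ℝ) 1))).measurable

/-- The random variable `exp(i t · ∫_0^1 b(α + s (β - α), X_s) ds) f(X_1)`. -/
def fourierIntegrand (M : MarkovFamily E Ω) (b : (unitInterval × E) →ᵇ Vec d) (t : Vec d)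
    (α β : unitInterval) (f : BM E) (ω : Ω) : ℂ :=
  Complex.exp (Complex.I * (inner ℝ t (pathIntegral M b α β ω) : ℝ)) * f.toFun (M.X 1 ω)

theorem measurable_fourierIntegrand (M : MarkovFamily E Ω) (b : (unitInterval × E) →ᵇ Vec d)
    (t : Vec d) (α β : unitInterval) (f : BM E) :
    Measurable (fourierIntegrand M b t α β f) := by
  have h1 : Measurable fun ω => (inner ℝ t (pathIntegral M b α β ω) : ℝ) :=
    (by fun_prop : Continuous fun v : Vec d => (inner ℝ t v : ℝ)).measurable.comp
      (measurable_pathIntegral M b α β)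
  exact (Complex.measurable_exp.comp ((Complex.measurable_ofReal.comp h1).const_mul _)).mul
    (f.measurable.comp (M.measurable_X 1))

theorem norm_fourierIntegrand_le {E Ω : Type*} [MetricSpace E] [MeasurableSpace E]
    [MeasurableSpace Ω] {d : ℕ} (M : MarkovFamily E Ω) (b : (unitInterval × E) →ᵇ Vec d)
    (t : Vec d) (α β : unitInterval) (f : BM E) (ω : Ω) :
    ‖fourierIntegrand M b t α β f ω‖ ≤ ‖f‖ := by
  unfold fourierIntegrand
  rw [norm_mul, mul_comm Complex.I, Complex.norm_exp_ofReal_mul_I, one_mul]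
  exact f.norm_apply_le _

theorem integrable_fourierIntegrand (M : MarkovFamily E Ω) (b : (unitInterval × E) →ᵇ Vec d)
    (t : Vec d) (α β : unitInterval) (f : BM E) (x : E) :
    Integrable (fourierIntegrand M b t α β f) (M.law x) := by
  have := M.isMarkov
  exact Integrable.of_bound (measurable_fourierIntegrand M b t α β f).aestronglyMeasurable ‖f‖
    (Eventually.of_forall (norm_fourierIntegrand_le M b t α β f))

theorem norm_integral_fourierIntegrand_le (M : MarkovFamily E Ω)
    (b : (unitInterval × E) →ᵇ Vec d) (t : Vec d) (α β : unitInterval) (f : BM E) (x : E) :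
    ‖∫ ω, fourierIntegrand M b t α β f ω ∂(M.law x)‖ ≤ ‖f‖ := by
  have := M.isMarkov
  simpa using norm_integral_le_of_norm_le_const (μ := M.law x)
    (Eventually.of_forall (norm_fourierIntegrand_le M b t α β f))

/-- The value `x ↦ E_x[exp(i t · ∫_0^1 b(α + s (β - α), X_s) ds) f(X_1)]` of the Fourier operator
at `f`. -/
def fourierFun (M : MarkovFamily E Ω) (b : (unitInterval × E) →ᵇ Vec d) (t : Vec d)
    (α β : unitInterval) (f : BM E) : BM E :=
  BM.mk (fun x => ∫ ω, fourierIntegrand M b t α β f ω ∂(M.law x))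
    ((measurable_fourierIntegrand M b t α β f).stronglyMeasurable.integral_kernel).measurable
    ‖f‖ (norm_integral_fourierIntegrand_le M b t α β f)

/-- The bounded linear operator `Q(t, α, β)` on the bounded measurable functions,
`Q(t, α, β) f (x) = E_x[exp(i t · ∫_0^1 b(α + s (β - α), X_s) ds) f(X_1)]`. -/
def Q (M : MarkovFamily E Ω) (b : (unitInterval × E) →ᵇ Vec d) (t : Vec d)
    (α β : unitInterval) : BM E →L[ℂ] BM E :=
  LinearMap.mkContinuous
    { toFun := fourierFun M b t α β
      map_add' := fun f g => by
        refine Subtype.ext (lp.ext (funext fun x => ?_))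
        refine Eq.trans ?_ (integral_add (integrable_fourierIntegrand M b t α β f x)
          (integrable_fourierIntegrand M b t α β g x))
        refine integral_congr_ae (Eventually.of_forall fun ω => ?_)
        exact mul_add _ _ _
      map_smul' := fun c f => by
        refine Subtype.ext (lp.ext (funext fun x => ?_))
        refine Eq.trans ?_ (integral_const_mul c (fourierIntegrand M b t α β f))
        refine integral_congr_ae (Eventually.of_forall fun ω => ?_)
        exact mul_left_comm _ _ _ }
    1 fun f => by
      rw [one_mul]
      exact lp.norm_le_of_forall_le (norm_nonneg _)
        (norm_integral_fourierIntegrand_le M b t α β f)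

theorem Q_apply (M : MarkovFamily E Ω) (b : (unitInterval × E) →ᵇ Vec d) (t : Vec d)
    (α β : unitInterval) (f : BM E) (x : E) :
    (Q M b t α β f).toFun x = ∫ ω, Complex.exp (Complex.I * (inner ℝ t
      (∫ s in (0 : ℝ)..1, b (projIcc 0 1 zero_le_one ((α : ℝ) + s * ((β : ℝ) - α)),
        M.X s.toNNReal ω)) : ℝ)) * f.toFun (M.X 1 ω) ∂(M.law x) :=
  rfl

/-- The non-arithmetic condition. -/
def NonArithmetic (M : MarkovFamily E Ω) (b : (unitInterval × E) →ᵇ Vec d) : Prop :=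
  ∀ (α : unitInterval) (t : Vec d), t ≠ 0 → spectralRadius ℂ (Q M b t α α) < 1

/-- The non-lattice condition: for no `α` is there a coset `a + H` of a proper closed subgroup `H`
of `ℝ^d` and a bounded measurable `u` with `∫_0^1 b(α, X_s) ds + u(X_1) - u(X_0) ∈ a + H` almost
surely for the process with initial distribution `ν`. -/
def NonLatticeCond (M : MarkovFamily E Ω) (ν : Measure E) (b : (unitInterval × E) →ᵇ Vec d) :
    Prop :=
  ∀ α : unitInterval, ¬ ∃ (a : Vec d) (H : AddSubgroup (Vec d)) (u : E → Vec d),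
    IsClosed (H : Set (Vec d)) ∧ H ≠ ⊤ ∧ Measurable u ∧ (∃ C : ℝ, ∀ x, ‖u x‖ ≤ C) ∧
      ∀ᵐ ω ∂(M.lawFrom ν), ∃ h ∈ H,
        (∫ s in (0 : ℝ)..1, b (α, M.X s.toNNReal ω)) + u (M.X 1 ω) - u (M.X 0 ω) = a + h

end Fourier

end NonLattice

end

noncomputable section

namespace NonLattice

/-! ### The Markov property for pairs of times -/

section Markov

variable {E Ω : Type*} [TopologicalSpace E] [MeasurableSpace E] [MeasurableSpace Ω]
  (M : MarkovFamily E Ω)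

/-! Lattice relation gives spectral radius at least one. A proper closed subgroup `H` admits `t ≠ 0`
with `t · H ⊆ ℤ` (`exists_inner_of_isClosed`). With `τ = 2πt`, exponentiating the relation makes `f
= exp(iτ · u)` satisfy `Q f = exp(iτ · a) f` `ν`-a.e. Iterating, `Q^n f` has modulus one somewhere
for every `n`, and Gelfand's formula gives `r(Q) ≥ 1`.

Conversely, let `r(Q) ≥ 1`. As `‖Q‖ ≤ 1`, some spectral value `z` of modulus one lies on the
boundary of the spectrum, so there are unit vectors `f_n` with `Q f_n - z f_n → 0` in sup norm
(`exists_approx_eigenvector`). Consider `A g = phase · g(X_1) - z g(X_0)` from `L²(ν)` to `L²(P_ν)`.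
Since `⟨g(X_0), phase · f(X_1)⟩ = ⟨g, Q f⟩`, expanding a square gives `A f_n → 0`
(`norm_twistL2_sub_sq_le`).

If `A g = 0`, then `|g(X_1)| = |g(X_0)|`. Ergodicity of the integer-time skeleton leaves `g = 0` or
`g ≠ 0` a.e., and in the latter case `arg g` supplies the forbidden `u`
(`NonLatticeCond.ae_eq_zero`). Thus non-latticeness makes `A` injective, and `f_n → 0` weakly in
`L²(ν)` (`tendsto_inner_of_injective`). Mixing excludes this (`not_tendsto_inner_zero`): up to mass
`1 - δ/2`, the law `P(N, x, ·)` has bounded density with respect to `ν`, which turns weak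
convergence into pointwise convergence, then into `L¹(ν)` convergence, and finally into `‖f_n‖ < 1`
for some `n`.

Uniqueness of the invariant measure concerns all times, whereas `Q` only sees integer times. The gap
is closed by right continuity of paths together with the lower bound `δ` on the measure of non-null
skeleton-invariant sets. -/

instance : IsMarkovKernel M.law := M.isMarkov

instance (s : ℝ≥0) : IsMarkovKernel (M.transition s) :=
  Kernel.IsMarkovKernel.map _ (M.measurable_X s)

theorem transition_apply (s : ℝ≥0) (x : E) : M.transition s x = (M.law x).map (M.X s) :=
  Kernel.map_apply _ (M.measurable_X s) x

theorem measurable_pair (s t : ℝ≥0) : Measurable fun ω => (M.X s ω, M.X t ω) :=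
  (M.measurable_X s).prodMk (M.measurable_X t)

theorem iSup_comap_X_le (s : ℝ≥0) :
    (⨆ r ∈ Iic s, MeasurableSpace.comap (M.X r) inferInstance) ≤ ‹MeasurableSpace Ω› :=
  iSup₂_le fun r _ => (M.measurable_X r).comap_le

/-- The defining property of the conditional expectation in `markov`, tested on the event `X_s ∈ A`
of the past and rewritten with values in `[0,∞]`. All later uses of the Markov property pass through
it. -/
theorem law_inter (x : E) (s t : ℝ≥0) {A B : Set E} (hA : MeasurableSet A)
    (hB : MeasurableSet B) :
    M.law x (M.X s ⁻¹' A ∩ M.X (s + t) ⁻¹' B)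
      = ∫⁻ y in A, M.transition t y B ∂(M.transition s x) := by
  have hAm : MeasurableSet[⨆ r ∈ Iic s, MeasurableSpace.comap (M.X r) inferInstance]
      (M.X s ⁻¹' A) :=
    (le_iSup₂_of_le (f := fun r (_ : r ∈ Iic s) =>
      MeasurableSpace.comap (M.X r) (inferInstance : MeasurableSpace E)) s self_mem_Iic le_rfl)
      _ ⟨A, hA, rfl⟩
  have hAX : MeasurableSet (M.X s ⁻¹' A) := M.measurable_X s hA
  have hBX : MeasurableSet (M.X (s + t) ⁻¹' B) := M.measurable_X _ hB
  have h1 := setIntegral_condExp (μ := M.law x) (iSup_comap_X_le M s)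
    (f := (M.X (s + t) ⁻¹' B).indicator fun _ => (1 : ℝ))
    ((integrable_const (1 : ℝ)).indicator hBX) hAm
  rw [setIntegral_congr_ae hAX ((M.markov x s t B hB).mono fun _ h _ => h),
    integral_indicator hBX, Measure.restrict_restrict hBX, setIntegral_const, smul_eq_mul,
    mul_one] at h1
  have h2 : Measurable fun y => M.transition t y B := Kernel.measurable_coe _ hB
  have h3 : ∀ y, (M.law y).real (M.X t ⁻¹' B) = (M.transition t y B).toReal := fun y => by
    rw [transition_apply, Measure.map_apply (M.measurable_X t) hB, measureReal_def]
  simp only [h3] at h1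
  have h4 : ∫ ω in M.X s ⁻¹' A, (M.transition t (M.X s ω) B).toReal ∂(M.law x)
      = (∫⁻ ω in M.X s ⁻¹' A, M.transition t (M.X s ω) B ∂(M.law x)).toReal :=
    integral_toReal (h2.comp (M.measurable_X s)).aemeasurable
      (Eventually.of_forall fun ω => measure_lt_top _ _)
  rw [h4] at h1
  rw [transition_apply M s, setLIntegral_map hA h2 (M.measurable_X s), inter_comm]
  refine ((ENNReal.toReal_eq_toReal_iff' ?_ (measure_ne_top _ _)).1 h1).symm
  refine ne_of_lt (lt_of_le_of_lt (lintegral_mono fun ω => prob_le_one) ?_)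
  simp

theorem law_map_pair (x : E) (s t : ℝ≥0) :
    (M.law x).map (fun ω => (M.X s ω, M.X (s + t) ω))
      = (M.transition s x) ⊗ₘ (M.transition t) := by
  refine Measure.ext_prod fun {A B} hA hB => ?_
  rw [Measure.map_apply (measurable_pair M _ _) (hA.prod hB), Measure.compProd_apply_prod hA hB,
    ← law_inter M x s t hA hB]
  rfl

theorem chapman_kolmogorov (s t : ℝ≥0) :
    M.transition (s + t) = M.transition t ∘ₖ M.transition s := by
  ext x A hA
  have h := law_inter M x s t MeasurableSet.univ hA
  rw [Kernel.comp_apply' _ _ _ hA, transition_apply, Measure.map_apply (M.measurable_X _) hA]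
  simpa using h

theorem lintegral_transition_add (s t : ℝ≥0) (x : E) {g : E → ℝ≥0∞} (hg : Measurable g) :
    ∫⁻ z, g z ∂(M.transition (s + t) x)
      = ∫⁻ y, ∫⁻ z, g z ∂(M.transition t y) ∂(M.transition s x) := by
  rw [chapman_kolmogorov, Kernel.lintegral_comp _ _ _ hg]

variable {M} {ν : Measure E}

instance [IsProbabilityMeasure ν] : IsProbabilityMeasure (M.lawFrom ν) := by
  unfold MarkovFamily.lawFrom; infer_instance

theorem ae_lawFrom_iff {p : Ω → Prop} (hp : MeasurableSet {ω | p ω}) :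
    (∀ᵐ ω ∂(M.lawFrom ν), p ω) ↔ ∀ᵐ x ∂ν, ∀ᵐ ω ∂(M.law x), p ω := by
  unfold MarkovFamily.lawFrom
  exact Measure.ae_comp_iff hp

theorem lintegral_lawFrom {g : Ω → ℝ≥0∞} (hg : Measurable g) :
    ∫⁻ ω, g ω ∂(M.lawFrom ν) = ∫⁻ x, ∫⁻ ω, g ω ∂(M.law x) ∂ν := by
  unfold MarkovFamily.lawFrom
  exact Measure.lintegral_bind M.law.aemeasurable hg.aemeasurable

theorem MarkovFamily.IsInvariant.lintegral (h : M.IsInvariant ν) (s : ℝ≥0) {g : E → ℝ≥0∞}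
    (hg : Measurable g) : ∫⁻ x, ∫⁻ y, g y ∂(M.transition s x) ∂ν = ∫⁻ x, g x ∂ν := by
  conv_rhs => rw [← (h.2 s).def]
  exact (Measure.lintegral_bind (M.transition s).aemeasurable hg.aemeasurable).symm

/-- Stationarity for pairs of times: the right side does not depend on `s`, so almost sure relations
between `X_0` and `X_t` can be shifted in time. -/
theorem MarkovFamily.IsInvariant.lawFrom_map_pair (h : M.IsInvariant ν) (s t : ℝ≥0) :
    (M.lawFrom ν).map (fun ω => (M.X s ω, M.X (s + t) ω)) = ν ⊗ₘ (M.transition t) := by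
  have := h.1
  ext A hA
  rw [Measure.map_apply (measurable_pair M _ _) hA, ← lintegral_indicator_one
    (measurable_pair M _ _ hA), lintegral_lawFrom (measurable_one.indicator
    (measurable_pair M _ _ hA)), Measure.compProd_apply hA,
    ← h.lintegral s (Kernel.measurable_kernel_prodMk_left hA)]
  refine lintegral_congr fun x => ?_
  rw [lintegral_indicator_one (measurable_pair M _ _ hA), ← Measure.compProd_apply hA,
    ← law_map_pair M x s t, Measure.map_apply (measurable_pair M _ _) hA]

theorem MarkovFamily.IsInvariant.measurePreserving_X (h : M.IsInvariant ν) (s : ℝ≥0) :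
    MeasurePreserving (M.X s) (M.lawFrom ν) ν := by
  have := h.1
  refine ⟨M.measurable_X s, ?_⟩
  have h1 := congrArg (Measure.map Prod.fst) (h.lawFrom_map_pair s 0)
  rw [Measure.map_map measurable_fst (measurable_pair M _ _)] at h1
  have h2 : (ν ⊗ₘ M.transition 0).map Prod.fst = ν := Measure.fst_compProd ν (M.transition 0)
  rw [h2] at h1
  exact h1

theorem MarkovFamily.IsInvariant.ae_shift (h : M.IsInvariant ν) (s t : ℝ≥0) {p : E × E → Prop}
    (hp : MeasurableSet {z | p z}) (hae : ∀ᵐ ω ∂(M.lawFrom ν), p (M.X 0 ω, M.X t ω)) :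
    ∀ᵐ ω ∂(M.lawFrom ν), p (M.X s ω, M.X (s + t) ω) := by
  have e := (h.lawFrom_map_pair s t).trans (h.lawFrom_map_pair 0 t).symm
  have h0 := (ae_map_iff (μ := M.lawFrom ν) (measurable_pair M 0 (0 + t)).aemeasurable hp).2
    (by simpa using hae)
  rw [← e] at h0
  exact (ae_map_iff (measurable_pair M s (s + t)).aemeasurable hp).1 h0

/-- If two functions agree `ν`-almost everywhere, they agree almost surely along the process. -/
theorem MarkovFamily.IsInvariant.ae_transition (h : M.IsInvariant ν) (s : ℝ≥0) {p : E → Prop}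
    (hp : ∀ᵐ x ∂ν, p x) : ∀ᵐ x ∂ν, ∀ᵐ y ∂(M.transition s x), p y := by
  have h1 := hp
  rw [← (h.2 s).def] at h1
  exact Measure.ae_ae_of_ae_comp h1

end Markov

/-! ### The total variation bound at integer times -/

section TV

variable {E : Type*} [MeasurableSpace E]

theorem abs_sub_le_tvDist (μ ν : Measure E) [IsProbabilityMeasure μ] [IsProbabilityMeasure ν]
    {A : Set E} (hA : MeasurableSet A) : |μ.real A - ν.real A| ≤ tvDist μ ν := by
  refine le_ciSup (f := fun A : {A : Set E // MeasurableSet A} => |μ.real A - ν.real A|)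
    ⟨1, ?_⟩ ⟨A, hA⟩
  rintro _ ⟨B, rfl⟩
  have h1 := measureReal_le_one (μ := μ) (s := (B : Set E))
  have h2 := measureReal_le_one (μ := ν) (s := (B : Set E))
  have h3 := measureReal_nonneg (μ := μ) (s := (B : Set E))
  have h4 := measureReal_nonneg (μ := ν) (s := (B : Set E))
  exact abs_le.2 ⟨by linarith, by linarith⟩

theorem tvDist_le_one (μ ν : Measure E) [IsProbabilityMeasure μ] [IsProbabilityMeasure ν] :
    tvDist μ ν ≤ 1 := by
  have : Nonempty {A : Set E // MeasurableSet A} := ⟨⟨∅, .empty⟩⟩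
  refine ciSup_le fun B => ?_
  have h1 := measureReal_le_one (μ := μ) (s := (B : Set E))
  have h2 := measureReal_le_one (μ := ν) (s := (B : Set E))
  have h3 := measureReal_nonneg (μ := μ) (s := (B : Set E))
  have h4 := measureReal_nonneg (μ := ν) (s := (B : Set E))
  exact abs_le.2 ⟨by linarith, by linarith⟩

end TV

section Mixing

variable {E Ω : Type*} [TopologicalSpace E] [MeasurableSpace E] [MeasurableSpace Ω]
  {M : MarkovFamily E Ω} {ν : Measure E}

/-- For `N ≥ T`, `P(N, x, A)` is the average of `P(T, y, A)` over `y` with law `P(N - T, x, ·)`, so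
the bound survives. An integer time is wanted because `Q^N` runs the process for time `N`. -/
theorem Mixing.exists_nat (h : Mixing M ν) : ∃ (N : ℕ) (δ : ℝ), 0 < δ ∧
    ∀ (x : E) (A : Set E), MeasurableSet A →
      |(M.transition N x).real A - ν.real A| ≤ 1 - δ := by
  obtain ⟨⟨hinv, -⟩, T, -, hT⟩ := h
  have := hinv.1
  obtain ⟨N, hN⟩ := exists_nat_ge T
  have hbdd : BddAbove (range fun x => tvDist (M.transition T x) ν) :=
    ⟨1, by rintro _ ⟨x, rfl⟩; exact tvDist_le_one _ _⟩
  refine ⟨N, 1 - ⨆ x, tvDist (M.transition T x) ν, by linarith, fun x A hA => ?_⟩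
  have h1 : ∀ y, |(M.transition T y).real A - ν.real A|
      ≤ ⨆ x, tvDist (M.transition T x) ν := fun y =>
    (abs_sub_le_tvDist _ _ hA).trans (le_ciSup hbdd y)
  have hm : Measurable fun y => (M.transition T y).real A :=
    (Kernel.measurable_coe _ hA).ennreal_toReal
  have hi : Integrable (fun y => (M.transition T y).real A) (M.transition (N - T) x) :=
    Integrable.of_bound hm.aestronglyMeasurable 1 (Eventually.of_forall fun y => by
      rw [Real.norm_of_nonneg measureReal_nonneg]; exact measureReal_le_one)
  have h2 : (M.transition N x).real A
      = ∫ y, (M.transition T y).real A ∂(M.transition (N - T) x) := by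
    have : (N : ℝ≥0) = (N - T) + T := (tsub_add_cancel_of_le hN).symm
    conv_lhs => rw [this, chapman_kolmogorov, measureReal_def, Kernel.comp_apply' _ _ _ hA]
    exact (integral_toReal (Kernel.measurable_coe _ hA).aemeasurable
      (Eventually.of_forall fun y => measure_lt_top _ _)).symm
  have h3 : (M.transition N x).real A - ν.real A
      = ∫ y, ((M.transition T y).real A - ν.real A) ∂(M.transition (N - T) x) := by
    rw [integral_sub hi (integrable_const _), h2]
    simp
  rw [h3, sub_sub_cancel]
  have := norm_integral_le_of_norm_le_const (μ := M.transition (N - T) x)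
    (f := fun y => (M.transition T y).real A - ν.real A) (Eventually.of_forall h1)
  simpa using this

end Mixing

/-! ### Sets that the stationary process does not leave or enter -/

/-- The stationary process is, almost surely, in `A` at time `t` if and only if it is in `A` at
time `0`. -/
def MarkovFamily.InvariantSet {E Ω : Type*} [TopologicalSpace E] [MeasurableSpace E]
    [MeasurableSpace Ω] (M : MarkovFamily E Ω) (ν : Measure E) (t : ℝ≥0) (A : Set E) : Prop :=
  ∀ᵐ ω ∂(M.lawFrom ν), M.X 0 ω ∈ A ↔ M.X t ω ∈ A

theorem measurableSet_iff_pair {E : Type*} [MeasurableSpace E] {A B : Set E} (hA : MeasurableSet A) (hB : MeasurableSet B) :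
    MeasurableSet {z : E × E | z.1 ∈ A ↔ z.2 ∈ B} :=
  ((hA.mem.comp measurable_fst).iff (hB.mem.comp measurable_snd)).setOf

section InvariantSet

variable {E Ω : Type*} [TopologicalSpace E] [MeasurableSpace E] [MeasurableSpace Ω]
  {M : MarkovFamily E Ω} {ν : Measure E} {A : Set E}

theorem MarkovFamily.InvariantSet.shift (h : M.IsInvariant ν) {t : ℝ≥0}
    (hA : MeasurableSet A) (hi : M.InvariantSet ν t A) (s : ℝ≥0) :
    ∀ᵐ ω ∂(M.lawFrom ν), M.X s ω ∈ A ↔ M.X (s + t) ω ∈ A :=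
  h.ae_shift s t (p := fun z => z.1 ∈ A ↔ z.2 ∈ A) (measurableSet_iff_pair hA hA) hi

theorem MarkovFamily.InvariantSet.nsmul (h : M.IsInvariant ν) {t : ℝ≥0}
    (hA : MeasurableSet A) (hi : M.InvariantSet ν t A) (n : ℕ) :
    M.InvariantSet ν (n • t) A := by
  induction n with
  | zero => simp [MarkovFamily.InvariantSet]
  | succ k ih =>
    rw [succ_nsmul]
    filter_upwards [ih, hi.shift h hA (k • t)] with ω h1 h2
    exact h1.trans h2

theorem MarkovFamily.InvariantSet.ae_transition (hs : ∀ x, ∀ᵐ ω ∂(M.law x), M.X 0 ω = x)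
    {t : ℝ≥0} (hA : MeasurableSet A) (hi : M.InvariantSet ν t A) :
    ∀ᵐ x ∂ν, ∀ᵐ y ∂(M.transition t x), x ∈ A ↔ y ∈ A := by
  have hm : MeasurableSet {ω | M.X 0 ω ∈ A ↔ M.X t ω ∈ A} :=
    measurable_pair M 0 t (measurableSet_iff_pair hA hA)
  filter_upwards [(ae_lawFrom_iff hm).1 hi] with x hx
  rw [transition_apply, ae_map_iff (M.measurable_X t).aemeasurable
    (measurable_const.iff hA.mem).setOf]
  filter_upwards [hx, hs x] with ω h1 h2
  rwa [h2] at h1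

/-- An invariant set of positive measure has measure bounded below. -/
theorem MarkovFamily.InvariantSet.le_measure (h : M.IsInvariant ν) {N : ℕ} {δ : ℝ}
    (hδ : ∀ (x : E) (A : Set E), MeasurableSet A →
      |(M.transition N x).real A - ν.real A| ≤ 1 - δ)
    (hA : MeasurableSet A) (hi : M.InvariantSet ν 1 A) (h0 : ν A ≠ 0) : δ ≤ ν.real A := by
  have := h.1
  have hN : M.InvariantSet ν N A := by simpa using hi.nsmul h hA N
  -- From such a point `P(N, x, A) = 1`, and the mixing bound forces `ν(A) ≥ δ`.
  obtain ⟨x, hxA, hx⟩ : ∃ x ∈ A, ∀ᵐ y ∂(M.transition N x), x ∈ A ↔ y ∈ A := by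
    by_contra hcon
    refine h0 (measure_eq_zero_iff_ae_notMem.2 ?_)
    filter_upwards [hN.ae_transition M.start hA] with x hx' hx
    exact hcon ⟨x, hx, hx'⟩
  have h1 : (M.transition N x).real A = 1 := by
    rw [measureReal_def, (mem_ae_iff_prob_eq_one hA).1, ENNReal.toReal_one]
    filter_upwards [hx] with y hy using hy.1 hxA
  have := hδ x A hA
  rw [h1] at this
  linarith [(abs_le.1 this).2]

/-- The event `X_s ∈ A` is decided by `X_0`. By invariance `P(1, x, A)` is `0` or `1`; splitting the
unit of time as `(1 - s) + s`, so is `P(s, y, A)` for almost every `y` reached at time `1 - s`,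
hence `ν`-a.e. by stationarity. -/
theorem MarkovFamily.InvariantSet.exists_iff (h : M.IsInvariant ν) (hA : MeasurableSet A)
    (hi : M.InvariantSet ν 1 A) {s : ℝ≥0} (hs : s ≤ 1) :
    ∃ B, MeasurableSet B ∧ ∀ᵐ ω ∂(M.lawFrom ν), M.X 0 ω ∈ B ↔ M.X s ω ∈ A := by
  have := h.1
  have hm : ∀ C : Set E, MeasurableSet C → Measurable fun y => M.transition s y C :=
    fun C hC => Kernel.measurable_coe _ hC
  have hzero : ∀ C : Set E, MeasurableSet C → ∀ x, M.transition 1 x C = 0 →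
      ∀ᵐ y ∂(M.transition (1 - s) x), M.transition s y C = 0 := fun C hC x hx => by
    have h1 := lintegral_transition_add M (1 - s) s x
      ((measurable_one (α := ℝ≥0∞) (β := E)).indicator hC)
    simp only [lintegral_indicator_one hC] at h1
    rw [tsub_add_cancel_of_le hs, hx] at h1
    exact (lintegral_eq_zero_iff (hm C hC)).1 h1.symm
  have hq : ∀ᵐ y ∂ν, M.transition s y A = 0 ∨ M.transition s y Aᶜ = 0 := by
    have hqm : MeasurableSet {y | M.transition s y A = 0 ∨ M.transition s y Aᶜ = 0} :=
      (measurableSet_eq_fun (hm A hA) measurable_const).union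
        (measurableSet_eq_fun (hm _ hA.compl) measurable_const)
    rw [← (h.2 (1 - s)).def]
    refine (Measure.ae_comp_iff hqm).2 ?_
    filter_upwards [hi.ae_transition M.start hA] with x hx
    by_cases hxA : x ∈ A
    · have : M.transition 1 x Aᶜ = 0 := by
        refine measure_eq_zero_iff_ae_notMem.2 ?_
        filter_upwards [hx] with y h2 hy using hy (h2.1 hxA)
      exact (hzero _ hA.compl x this).mono fun y hy => Or.inr hy
    · have : M.transition 1 x A = 0 := by
        refine measure_eq_zero_iff_ae_notMem.2 ?_
        filter_upwards [hx] with y h2 hy using hxA (h2.2 hy)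
      exact (hzero _ hA x this).mono fun y hy => Or.inl hy
  have hBm : MeasurableSet {y | M.transition s y Aᶜ = 0} :=
    measurableSet_eq_fun (hm _ hA.compl) measurable_const
  refine ⟨{y | M.transition s y Aᶜ = 0}, hBm, ?_⟩
  refine (ae_lawFrom_iff (measurable_pair M 0 s (measurableSet_iff_pair hBm hA))).2 ?_
  filter_upwards [hq] with x hx
  by_cases hxB : M.transition s x Aᶜ = 0
  · have h1 := hxB
    rw [transition_apply, Measure.map_apply (M.measurable_X s) hA.compl] at h1
    filter_upwards [M.start x, measure_eq_zero_iff_ae_notMem.1 h1] with ω h2 h3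
    rw [h2]
    exact ⟨fun _ => not_not.1 h3, fun _ => hxB⟩
  · have h1 := hx.resolve_right hxB
    rw [transition_apply, Measure.map_apply (M.measurable_X s) hA] at h1
    filter_upwards [M.start x, measure_eq_zero_iff_ae_notMem.1 h1] with ω h2 h3
    rw [h2]
    exact ⟨fun h4 => absurd h4 hxB, fun h4 => absurd h4 h3⟩

/-- If the process rarely changes its side of `A` up to a small time `s`, then an invariant set
of the skeleton at times `0, 1, 2, …` is invariant at time `s`. -/
theorem MarkovFamily.InvariantSet.of_measure_lt (h : M.IsInvariant ν) {N : ℕ} {δ : ℝ}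
    (hδ : ∀ (x : E) (A : Set E), MeasurableSet A →
      |(M.transition N x).real A - ν.real A| ≤ 1 - δ)
    (hA : MeasurableSet A) (hi : M.InvariantSet ν 1 A) {s : ℝ≥0} (hs : s ≤ 1)
    (hlt : (M.lawFrom ν).real {ω | ¬ (M.X 0 ω ∈ A ↔ M.X s ω ∈ A)} < δ) :
    M.InvariantSet ν s A := by
  have := h.1
  obtain ⟨B, hB, hBA⟩ := hi.exists_iff h hA hs
  have hDm : MeasurableSet {x | ¬ (x ∈ A ↔ x ∈ B)} := ((hA.mem.iff hB.mem).not).setOf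
  -- Membership of `X_1` in `B` means `X_{1+s} ∈ A`, equivalently `X_s ∈ A`, equivalently `X_0 ∈ B`.
  -- So `A △ B` is skeleton-invariant, and with measure below `δ` it must be null.
  have hD : M.InvariantSet ν 1 {x | ¬ (x ∈ A ↔ x ∈ B)} := by
    have h1 := h.ae_shift 1 s (p := fun z => z.1 ∈ B ↔ z.2 ∈ A) (measurableSet_iff_pair hB hA) hBA
    filter_upwards [hi, hBA, h1, hi.shift h hA s] with ω h2 h3 h4 h5
    rw [add_comm s 1] at h5
    tauto
  have hDν : ν.real {x | ¬ (x ∈ A ↔ x ∈ B)}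
      = (M.lawFrom ν).real {ω | ¬ (M.X 0 ω ∈ A ↔ M.X s ω ∈ A)} := by
    rw [← (h.measurePreserving_X 0).measureReal_preimage hDm.nullMeasurableSet]
    refine measureReal_congr ?_
    filter_upwards [hBA] with ω h2
    refine propext (not_congr (iff_congr Iff.rfl h2))
  have h0 : ν {x | ¬ (x ∈ A ↔ x ∈ B)} = 0 := by
    by_contra hne
    have := hD.le_measure h hδ hDm hne
    linarith
  have h1 : ∀ᵐ ω ∂(M.lawFrom ν), M.X 0 ω ∈ A ↔ M.X 0 ω ∈ B := by
    have : ∀ᵐ x ∂ν, x ∈ A ↔ x ∈ B := h0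
    exact (h.measurePreserving_X 0).quasiMeasurePreserving.ae this
  filter_upwards [h1, hBA] with ω h2 h3
  exact h2.trans h3

/-- A set that is invariant at all times has measure `0` or `1`. -/
theorem Mixing.measure_compl_eq_zero (h : Mixing M ν) (hA : MeasurableSet A)
    (hi : ∀ t, M.InvariantSet ν t A) (h0 : ν A ≠ 0) : ν Aᶜ = 0 := by
  have := h.1.1.1
  -- Conditioning `ν` on a set that is never left or entered gives another invariant law, which
  -- uniqueness identifies with `ν`.
  have hinv : M.IsInvariant (ProbabilityTheory.cond ν A) := by
    refine ⟨cond_isProbabilityMeasure h0, fun t => ?_⟩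
    refine Measure.ext fun B hB => ?_
    rw [Measure.bind_apply hB (M.transition t).aemeasurable, cond_apply hA, ProbabilityTheory.cond,
      lintegral_smul_measure, smul_eq_mul]
    congr 1
    rw [← Measure.compProd_apply_prod hA hB, ← h.1.1.lawFrom_map_pair 0 t,
      Measure.map_apply (measurable_pair M _ _) (hA.prod hB),
      ← (h.1.1.measurePreserving_X t).measure_preimage (hA.inter hB).nullMeasurableSet]
    refine measure_congr ?_
    filter_upwards [hi t] with ω h1
    rw [zero_add]
    refine propext (and_congr h1 Iff.rfl)
  have h1 := h.1.2 _ hinv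
  rw [← h1, cond_apply hA]
  simp

end InvariantSet

/-! ### Continuity at time `0` and ergodicity of the skeleton -/

section Ergodic

variable {E Ω : Type*} [MetricSpace E] [MeasurableSpace E] [BorelSpace E] [MeasurableSpace Ω]
  {M : MarkovFamily E Ω} {ν : Measure E} {A : Set E}

/-- Right continuity of paths at time `0` and dominated convergence. -/
theorem tendsto_integral_norm_sub (h : M.IsInvariant ν) (g : E →ᵇ ℝ) (t : ℝ≥0) :
    Tendsto (fun n : ℕ => ∫ ω, ‖g (M.X (t / (n + 1)) ω) - g (M.X 0 ω)‖ ∂(M.lawFrom ν))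
      atTop (𝓝 0) := by
  have := h.1
  have hlim : Tendsto (fun n : ℕ => (t / (n + 1) : ℝ≥0)) atTop (𝓝[≥] 0) := by
    refine tendsto_nhdsWithin_iff.2 ⟨?_, Eventually.of_forall fun n => zero_le (a := t / (n + 1))⟩
    simpa [div_eq_mul_inv] using
      (tendsto_one_div_add_atTop_nhds_zero_nat (𝕜 := ℝ≥0)).const_mul t
  rw [← integral_zero Ω ℝ (μ := M.lawFrom ν)]
  refine tendsto_integral_of_dominated_convergence (fun _ => 2 * ‖g‖) (fun n => ?_)
    (integrable_const _) (fun n => Eventually.of_forall fun ω => ?_)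
    (Eventually.of_forall fun ω => ?_)
  · exact (((g.continuous.measurable.comp (M.measurable_X _)).sub
      (g.continuous.measurable.comp (M.measurable_X _))).norm).aestronglyMeasurable
  · rw [norm_norm, ← dist_eq_norm]
    exact g.dist_le_two_norm _ _
  · have h1 : Tendsto (fun n : ℕ => g (M.X (t / (n + 1)) ω)) atTop (𝓝 (g (M.X 0 ω))) :=
      (g.continuous.tendsto _).comp (((M.cadlag ω 0).1.tendsto).comp hlim)
    exact tendsto_iff_norm_sub_tendsto_zero.1 h1

/-- Triangle inequality through a continuous approximation `g` of the indicator; by stationarity the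
errors at times `0` and `s` coincide, hence the factor `2`. -/
theorem measureReal_not_iff_le (h : M.IsInvariant ν) (hA : MeasurableSet A) (s : ℝ≥0)
    (g : E →ᵇ ℝ) :
    (M.lawFrom ν).real {ω | ¬ (M.X 0 ω ∈ A ↔ M.X s ω ∈ A)}
      ≤ 2 * ∫ x, ‖A.indicator (fun _ => (1 : ℝ)) x - g x‖ ∂ν
        + ∫ ω, ‖g (M.X s ω) - g (M.X 0 ω)‖ ∂(M.lawFrom ν) := by
  have := h.1
  obtain ⟨a, ha⟩ : ∃ a : E → ℝ, a = A.indicator fun _ => (1 : ℝ) := ⟨_, rfl⟩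
  rw [← ha]
  have ham : Measurable a := by rw [ha]; exact measurable_const.indicator hA
  have hai : Integrable a ν := by rw [ha]; exact (integrable_const (1 : ℝ)).indicator hA
  have hgm : Measurable g := g.continuous.measurable
  have hgi : Integrable g ν := Integrable.of_bound hgm.aestronglyMeasurable ‖g‖
    (Eventually.of_forall g.norm_coe_le_norm)
  have hi : Integrable (fun x => ‖a x - g x‖) ν := (hai.sub hgi).norm
  have hir : ∀ r, Integrable (fun ω => ‖a (M.X r ω) - g (M.X r ω)‖) (M.lawFrom ν) := fun r =>
    (h.measurePreserving_X r).integrable_comp_of_integrable (g := fun x => ‖a x - g x‖) hi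
  have hir' : ∀ r, ∫ ω, ‖a (M.X r ω) - g (M.X r ω)‖ ∂(M.lawFrom ν) = ∫ x, ‖a x - g x‖ ∂ν :=
    fun r => by
      conv_rhs => rw [← (h.measurePreserving_X r).map_eq]
      exact (integral_map (M.measurable_X r).aemeasurable
        ((ham.sub hgm).norm).aestronglyMeasurable).symm
  have hig : Integrable (fun ω => ‖g (M.X s ω) - g (M.X 0 ω)‖) (M.lawFrom ν) :=
    (((h.measurePreserving_X s).integrable_comp_of_integrable hgi).sub
      ((h.measurePreserving_X 0).integrable_comp_of_integrable hgi)).norm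
  have hSm : MeasurableSet {ω | ¬ (M.X 0 ω ∈ A ↔ M.X s ω ∈ A)} :=
    (measurable_pair M 0 s (measurableSet_iff_pair hA hA)).compl
  calc (M.lawFrom ν).real {ω | ¬ (M.X 0 ω ∈ A ↔ M.X s ω ∈ A)}
      = ∫ ω, {ω | ¬ (M.X 0 ω ∈ A ↔ M.X s ω ∈ A)}.indicator (fun _ => (1 : ℝ)) ω
          ∂(M.lawFrom ν) := by
        rw [integral_indicator hSm, setIntegral_const, smul_eq_mul, mul_one]
    _ ≤ ∫ ω, (‖a (M.X 0 ω) - g (M.X 0 ω)‖ + ‖a (M.X s ω) - g (M.X s ω)‖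
          + ‖g (M.X s ω) - g (M.X 0 ω)‖) ∂(M.lawFrom ν) := by
        refine integral_mono ((integrable_const _).indicator hSm)
          (((hir 0).add (hir s)).add hig) fun ω => ?_
        by_cases hω : M.X 0 ω ∈ A ↔ M.X s ω ∈ A
        · rw [indicator_of_notMem (show ω ∉ {ω | ¬ (M.X 0 ω ∈ A ↔ M.X s ω ∈ A)} from
            not_not.2 hω)]
          positivity
        · rw [indicator_of_mem (show ω ∈ {ω | ¬ (M.X 0 ω ∈ A ↔ M.X s ω ∈ A)} from hω)]
          have h1 : (1 : ℝ) = ‖a (M.X 0 ω) - a (M.X s ω)‖ := by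
            by_cases h0 : M.X 0 ω ∈ A <;> by_cases h1 : M.X s ω ∈ A <;> simp [ha, h0, h1] at hω ⊢
          have h2 : a (M.X 0 ω) - a (M.X s ω) = (a (M.X 0 ω) - g (M.X 0 ω))
            - (a (M.X s ω) - g (M.X s ω)) - (g (M.X s ω) - g (M.X 0 ω)) := by ring
          rw [h1, h2]
          exact (norm_sub_le _ _).trans (add_le_add_left (norm_sub_le _ _) _)
    _ = _ := by
        refine (integral_add ((hir 0).add (hir s)) hig).trans ?_
        rw [two_mul]
        refine congrArg (· + _) ((integral_add (hir 0) (hir s)).trans ?_)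
        rw [hir' 0, hir' s]

/-- The skeleton at integer times is ergodic. -/
theorem Mixing.measure_compl_eq_zero_of_one (h : Mixing M ν) (hA : MeasurableSet A)
    (hi : M.InvariantSet ν 1 A) (h0 : ν A ≠ 0) : ν Aᶜ = 0 := by
  obtain ⟨N, δ, hδ, hN⟩ := h.exists_nat
  have hinv := h.1.1
  have := hinv.1
  refine h.measure_compl_eq_zero hA (fun t => ?_) h0
  -- An approximation error of `δ/3` is counted twice, and the path oscillation below adds less than
  -- `δ/3`, for a total below `δ`.
  obtain ⟨g, hg, -⟩ := ((integrable_const (μ := ν) (1 : ℝ)).indicator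
    hA).exists_boundedContinuous_integral_sub_le (ε := δ / 3) (by positivity)
  obtain ⟨n, hn⟩ := exists_nat_ge t
  obtain ⟨m, hm, hnm⟩ := (((tendsto_integral_norm_sub hinv g t).eventually_lt_const
    (show 0 < δ / 3 by positivity)).and (eventually_ge_atTop n)).exists
  have hs : t / (m + 1) ≤ 1 := by
    refine div_le_one_of_le₀ (hn.trans ?_) zero_le
    exact_mod_cast hnm.trans m.le_succ
  have h1 : M.InvariantSet ν (t / (m + 1)) A := by
    refine hi.of_measure_lt hinv hN hA hs ?_
    linarith [measureReal_not_iff_le hinv hA (t / (m + 1)) g]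
  -- Time `t` is reached by `m + 1` steps of length `t / (m + 1)`.
  have h2 := h1.nsmul hinv hA (m + 1)
  rwa [nsmul_eq_mul, Nat.cast_add_one, mul_div_cancel₀ _ (by positivity)] at h2

end Ergodic

/-! ### Characters annihilating a closed subgroup of a Euclidean space -/

section ClosedSubgroup

variable {F : Type*} [NormedAddCommGroup F] [InnerProductSpace ℝ F]

/-- The largest linear subspace contained in a closed additive subgroup. -/
def lineSubspace (H : AddSubgroup F) : Submodule ℝ F where
  carrier := {v | ∀ c : ℝ, c • v ∈ H}
  add_mem' {v w} hv hw c := by rw [smul_add]; exact H.add_mem (hv c) (hw c)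
  zero_mem' c := by rw [smul_zero]; exact H.zero_mem
  smul_mem' a v hv c := by rw [smul_smul]; exact hv _

theorem lineSubspace_le (H : AddSubgroup F) {v : F} (hv : v ∈ lineSubspace H) : v ∈ H := by
  simpa using hv 1

/-- A closed subgroup without lines is discrete. -/
theorem discreteTopology_of_lineSubspace [FiniteDimensional ℝ F] {H : AddSubgroup F}
    (hH : IsClosed (H : Set F)) (hl : lineSubspace H = ⊥) : DiscreteTopology H := by
  by_contra hd
  have hsmall : ∀ n : ℕ, ∃ h ∈ H, h ≠ 0 ∧ ‖h‖ < 1 / (n + 1) := fun n => by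
    by_contra! hcon
    refine hd (discreteTopology_iff_isOpen_singleton_zero.2 ?_)
    refine Metric.isOpen_singleton_iff.2 ⟨1 / (n + 1), by positivity, fun y hy => ?_⟩
    by_contra hy0
    refine absurd (hcon y y.2 (by simpa using hy0)) (not_le.2 ?_)
    simpa using hy
  choose h hhH hh0 hh using hsmall
  have hmem : ∀ n, ‖h n‖⁻¹ • h n ∈ Metric.sphere (0 : F) 1 := fun n => by
    simp [norm_smul, inv_mul_cancel₀ (norm_ne_zero_iff.2 (hh0 n))]
  obtain ⟨v, hv, φ, hφ, hlim⟩ := (isCompact_sphere (0 : F) 1).tendsto_subseq hmem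
  have hn0 : Tendsto (fun n => ‖h (φ n)‖) atTop (𝓝 0) := by
    refine (squeeze_zero (fun _ => norm_nonneg _) (fun n => (hh n).le) ?_).comp hφ.tendsto_atTop
    exact tendsto_one_div_add_atTop_nhds_zero_nat
  have hvl : v ∈ lineSubspace H := fun c => by
    -- Integer multiples of ever shorter elements of `H` whose directions tend to `v` approximate `c
    -- • v`, so the closed group contains the line through `v`.
    have h1 : Tendsto (fun n => ((⌊c / ‖h (φ n)‖⌋ : ℝ) * ‖h (φ n)‖)) atTop (𝓝 c) := by
      rw [tendsto_iff_norm_sub_tendsto_zero]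
      refine squeeze_zero (fun _ => norm_nonneg _) (fun n => ?_) hn0
      have hp : 0 < ‖h (φ n)‖ := norm_pos_iff.2 (hh0 _)
      have h2 := Int.floor_le (c / ‖h (φ n)‖)
      have h3 := Int.lt_floor_add_one (c / ‖h (φ n)‖)
      rw [le_div_iff₀ hp] at h2
      rw [div_lt_iff₀ hp] at h3
      rw [Real.norm_eq_abs, abs_le]
      constructor <;> nlinarith
    refine hH.mem_of_tendsto (h1.smul hlim) (Eventually.of_forall fun n => ?_)
    simp only [Function.comp_apply, smul_smul]
    rw [mul_assoc, mul_inv_cancel₀ (norm_ne_zero_iff.2 (hh0 _)), mul_one,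
      Int.cast_smul_eq_zsmul]
    exact H.zsmul_mem (hhH _) _
  rw [hl, Submodule.mem_bot] at hvl
  simp [hvl] at hv

/-- A discrete subgroup of a nonzero Euclidean space is annihilated by a nontrivial character. -/
theorem exists_inner_of_discrete [FiniteDimensional ℝ F] [Nontrivial F] (H : AddSubgroup F)
    [hd : DiscreteTopology H] :
    ∃ t : F, t ≠ 0 ∧ ∀ h ∈ H, ∃ k : ℤ, inner ℝ t h = (k : ℝ) := by
  obtain ⟨L, rfl⟩ : ∃ L : Submodule ℤ F, L.toAddSubgroup = H :=
    ⟨AddSubgroup.toIntSubmodule H, rfl⟩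
  have : DiscreteTopology L := hd
  -- A full lattice has integral coordinates, and one coordinate functional serves as `t`. Otherwise
  -- any nonzero vector orthogonal to the span works, with `k = 0`.
  by_cases hs : Submodule.span ℝ (L : Set F) = ⊤
  · have : IsZLattice ℝ L := ⟨hs⟩
    have := ZLattice.module_free ℝ L
    obtain ⟨B, hB⟩ : ∃ B, B = (Module.Free.chooseBasis ℤ L).ofZLatticeBasis ℝ L := ⟨_, rfl⟩
    have hne := B.index_nonempty
    obtain ⟨i⟩ := hne
    refine ⟨(InnerProductSpace.toDual ℝ F).symm (LinearMap.toContinuousLinearMap (B.coord i)),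
      fun h0 => ?_, fun h hh => ⟨(Module.Free.chooseBasis ℤ L).repr ⟨h, hh⟩ i, ?_⟩⟩
    · have := InnerProductSpace.toDual_symm_apply (𝕜 := ℝ) (x := B i)
        (y := LinearMap.toContinuousLinearMap (B.coord i))
      rw [h0] at this
      simp at this
    · rw [InnerProductSpace.toDual_symm_apply]
      have := (Module.Free.chooseBasis ℤ L).ofZLatticeBasis_repr_apply ℝ L ⟨h, hh⟩ i
      rw [← hB] at this
      simpa using this
  · obtain ⟨t, ht, ht0⟩ := Submodule.exists_mem_ne_zero_of_ne_bot
      (mt Submodule.orthogonal_eq_bot_iff.1 hs)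
    refine ⟨t, ht0, fun h hh => ⟨0, ?_⟩⟩
    rw [real_inner_comm]
    simpa using ht h (Submodule.subset_span hh)

/-- A proper closed subgroup of a Euclidean space is annihilated by a nontrivial character. -/
theorem exists_inner_of_isClosed [FiniteDimensional ℝ F] (H : AddSubgroup F)
    (hH : IsClosed (H : Set F)) (hne : H ≠ ⊤) :
    ∃ t : F, t ≠ 0 ∧ ∀ h ∈ H, ∃ k : ℤ, inner ℝ t h = (k : ℝ) := by
  obtain ⟨V, hV⟩ : ∃ V, V = lineSubspace H := ⟨_, rfl⟩
  have hVH : ∀ v ∈ V, v ∈ H := fun v hv => lineSubspace_le H (hV ▸ hv)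
  have hnt : Nontrivial Vᗮ := by
    rw [Submodule.nontrivial_iff_ne_bot]
    refine fun hbot => hne (eq_top_iff.2 fun x _ => hVH x ?_)
    rw [Submodule.orthogonal_eq_bot_iff.1 hbot]
    trivial
  have hcl : IsClosed ((H.comap Vᗮ.subtype.toAddMonoidHom : AddSubgroup Vᗮ) : Set Vᗮ) :=
    hH.preimage continuous_subtype_val
  -- Every line of `H` lies in `V`, so none survives in `Vᗮ` and that part of `H` is discrete. A
  -- character found on `Vᗮ` kills `V`, hence controls all of `H`.
  have hl : lineSubspace (H.comap Vᗮ.subtype.toAddMonoidHom) = ⊥ := by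
    refine (Submodule.eq_bot_iff _).2 fun x hx => Subtype.ext ?_
    have hxV : (x : F) ∈ V := (congrArg ((x : F) ∈ ·) hV).mpr fun c => hx c
    exact inner_self_eq_zero.1 (Submodule.inner_right_of_mem_orthogonal (𝕜 := ℝ) hxV x.2)
  have := discreteTopology_of_lineSubspace hcl hl
  obtain ⟨t, ht0, ht⟩ := exists_inner_of_discrete (H.comap Vᗮ.subtype.toAddMonoidHom)
  refine ⟨t, by simpa using ht0, fun h hh => ?_⟩
  obtain ⟨v, hv, w, hw, rfl⟩ := Submodule.exists_add_mem_mem_orthogonal (K := V) h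
  have hwH : w ∈ H := by
    have := H.sub_mem hh (hVH v hv)
    rwa [add_sub_cancel_left] at this
  obtain ⟨k, hk⟩ := ht ⟨w, hw⟩ hwH
  refine ⟨k, ?_⟩
  rw [inner_add_right, Submodule.inner_left_of_mem_orthogonal hv t.2, zero_add, ← hk]
  rfl

end ClosedSubgroup

/-! ### Spectral radius and approximate eigenvectors of contractions -/

section Spectral

/-- Passes from `Q` to `Q^N`, since the mixing bound is available at time `N`. -/
theorem tendsto_iterate_sub {V : Type*} [NormedAddCommGroup V] [NormedSpace ℂ V] (T : V →L[ℂ] V) (z : ℂ) {f : ℕ → V}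
    (hf : Tendsto (fun n => ‖T (f n) - z • f n‖) atTop (𝓝 0)) (N : ℕ) :
    Tendsto (fun n => ‖T^[N] (f n) - z ^ N • f n‖) atTop (𝓝 0) := by
  induction N with
  | zero => simp
  | succ k ih =>
    have h1 : ∀ n, ‖T^[k + 1] (f n) - z ^ (k + 1) • f n‖
        ≤ ‖T‖ * ‖T^[k] (f n) - z ^ k • f n‖ + ‖z ^ k‖ * ‖T (f n) - z • f n‖ := fun n => by
      have h2 : T^[k + 1] (f n) - z ^ (k + 1) • f n
          = T (T^[k] (f n) - z ^ k • f n) + z ^ k • (T (f n) - z • f n) := by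
        rw [Function.iterate_succ_apply', map_sub, map_smul, smul_sub, smul_smul, pow_succ]
        abel
      rw [h2]
      refine (norm_add_le _ _).trans (add_le_add (T.le_opNorm _) (norm_smul _ _).le)
    refine squeeze_zero (fun _ => norm_nonneg _) h1 ?_
    simpa using (ih.const_mul ‖T‖).add (hf.const_mul ‖z ^ k‖)

variable {V : Type*} [NormedAddCommGroup V] [NormedSpace ℂ V] [CompleteSpace V]

theorem one_le_spectralRadius_of_le_norm_iterate (T : V →L[ℂ] V) {f : V} (hf : ‖f‖ ≤ 1)
    (hT : ∀ n : ℕ, 1 ≤ ‖T^[n] f‖) : 1 ≤ spectralRadius ℂ T := by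
  have hle : ∀ n : ℕ, 1 ≤ ‖T ^ n‖₊ := fun n => by
    have h1 := (T ^ n).le_opNorm f
    rw [FunLike.coe_pow_eq_iterate] at h1
    have h2 : (1 : ℝ) ≤ ‖T ^ n‖ := by
      nlinarith [norm_nonneg (T ^ n), norm_nonneg f, hT n]
    exact_mod_cast h2
  refine ge_of_tendsto (spectrum.pow_nnnorm_pow_one_div_tendsto_nhds_spectralRadius T)
    (Eventually.of_forall fun n => ?_)
  refine (ENNReal.one_rpow (1 / (n : ℝ))).symm.le.trans (ENNReal.rpow_le_rpow ?_ (by positivity))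
  exact_mod_cast hle n

/-- A boundary point of the spectrum is not a point where `T - z` is bounded below. -/
theorem exists_norm_sub_lt (T : V →L[ℂ] V) {z : ℂ} (hz : z ∈ spectrum ℂ T)
    (hcl : z ∈ closure (spectrum ℂ T)ᶜ) {c : ℝ} (hc : 0 < c) :
    ∃ f : V, ‖T f - z • f‖ < c * ‖f‖ := by
  by_contra! hcon
  -- Half of the lower bound `c` for `T - z` survives at `w`, so the resolvent at `w` has norm at
  -- most `2 / c`. Then `z` is within reach of a Neumann series.
  obtain ⟨w, hw, hzw⟩ := Metric.mem_closure_iff.1 hcl (c / 2) (by positivity)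
  rw [mem_compl_iff, spectrum.notMem_iff] at hw
  obtain ⟨U, hU⟩ := hw
  have hdist : ‖z - w‖ < c / 2 := by rwa [← dist_eq_norm]
  have hUi : ∀ f, ‖(↑U⁻¹ : V →L[ℂ] V) f‖ ≤ 2 / c * ‖f‖ := fun f => by
    obtain ⟨g, hg⟩ : ∃ g, g = (↑U⁻¹ : V →L[ℂ] V) f := ⟨_, rfl⟩
    have h1 : (U : V →L[ℂ] V) g = f := by
      rw [hg, ← mul_apply_eq_comp, Units.mul_inv]
      rfl
    rw [hU] at h1
    have h2 : T g - z • g = -f - (z - w) • g := by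
      rw [← h1, sub_smul]
      simp [Algebra.algebraMap_eq_smul_one]
    have h3 := hcon g
    rw [h2] at h3
    have h4 : ‖-f - (z - w) • g‖ ≤ ‖f‖ + ‖z - w‖ * ‖g‖ := by
      refine (norm_sub_le _ _).trans ?_
      rw [norm_neg, norm_smul]
    rw [← hg, div_mul_eq_mul_div, le_div_iff₀ hc]
    nlinarith [norm_nonneg g]
  have hnorm : ‖(↑U⁻¹ : V →L[ℂ] V)‖ ≤ 2 / c :=
    ContinuousLinearMap.opNorm_le_bound _ (by positivity) hUi
  have hlt : ‖(w - z) • (↑U⁻¹ : V →L[ℂ] V)‖ < 1 := by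
    rw [norm_smul, norm_sub_rev]
    calc ‖z - w‖ * ‖(↑U⁻¹ : V →L[ℂ] V)‖ ≤ ‖z - w‖ * (2 / c) := by gcongr
      _ < c / 2 * (2 / c) := by gcongr
      _ = 1 := by field_simp
  refine hz (spectrum.mem_resolventSet_iff.2 ?_)
  have h5 : (algebraMap ℂ (V →L[ℂ] V)) z - T
      = (U : V →L[ℂ] V) * (1 - (w - z) • (↑U⁻¹ : V →L[ℂ] V)) := by
    rw [mul_sub, mul_one, mul_smul_comm, Units.mul_inv, hU,
      Algebra.algebraMap_eq_smul_one, Algebra.algebraMap_eq_smul_one, sub_smul]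
    abel
  rw [h5]
  exact U.isUnit.mul (isUnit_one_sub_of_norm_lt_one hlt)

/-- A contraction with spectral radius `1` has approximate eigenvectors for an eigenvalue of
modulus `1`. -/
theorem exists_approx_eigenvector [Nontrivial V] (T : V →L[ℂ] V) (hT : ‖T‖ ≤ 1)
    (hr : 1 ≤ spectralRadius ℂ T) :
    ∃ z : ℂ, ‖z‖ = 1 ∧ ∃ f : ℕ → V, (∀ n, ‖f n‖ = 1) ∧
      Tendsto (fun n => ‖T (f n) - z • f n‖) atTop (𝓝 0) := by
  obtain ⟨z, hz, hzr⟩ := spectrum.exists_nnnorm_eq_spectralRadius T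
  have hz1 : ‖z‖ = 1 := by
    refine le_antisymm ((spectrum.norm_le_norm_of_mem hz).trans hT) ?_
    rw [← hzr] at hr
    exact_mod_cast hr
  -- Points slightly outward along the ray of `z` have modulus above `1 ≥ ‖T‖`.
  have hcl : z ∈ closure (spectrum ℂ T)ᶜ := by
    have hlim : Tendsto (fun n : ℕ => (1 + 1 / ((n : ℂ) + 1)) * z) atTop (𝓝 z) := by
      have := (tendsto_one_div_add_atTop_nhds_zero_nat (𝕜 := ℂ)).const_add 1
      simpa using this.mul_const z
    refine mem_closure_of_tendsto hlim (Eventually.of_forall fun n hn => ?_)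
    have h1 := (spectrum.norm_le_norm_of_mem hn).trans hT
    have h2 : ‖(1 + 1 / ((n : ℂ) + 1)) * z‖ = 1 + 1 / ((n : ℝ) + 1) := by
      rw [norm_mul, hz1, mul_one]
      have : (1 + 1 / ((n : ℂ) + 1)) = ((1 + 1 / ((n : ℝ) + 1) : ℝ) : ℂ) := by push_cast; rfl
      rw [this, Complex.norm_real, Real.norm_of_nonneg (by positivity)]
    rw [h2] at h1
    have : (0 : ℝ) < 1 / ((n : ℝ) + 1) := by positivity
    linarith
  choose g hg using fun n : ℕ => exists_norm_sub_lt T hz hcl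
    (show (0 : ℝ) < 1 / ((n : ℝ) + 1) by positivity)
  have hg0 : ∀ n, 0 < ‖g n‖ := fun n => by
    rw [norm_pos_iff]
    intro h0
    have := hg n
    simp [h0] at this
  refine ⟨z, hz1, fun n => ((‖g n‖⁻¹ : ℝ) : ℂ) • g n, fun n => ?_, ?_⟩
  · rw [norm_smul, Complex.norm_real, norm_inv, norm_norm, inv_mul_cancel₀ (hg0 n).ne']
  · refine squeeze_zero (fun _ => norm_nonneg _) (fun n => ?_)
      (tendsto_one_div_add_atTop_nhds_zero_nat (𝕜 := ℝ))
    rw [map_smul, smul_comm z, ← smul_sub, norm_smul, Complex.norm_real, norm_inv, norm_norm,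
      inv_mul_le_iff₀ (hg0 n), mul_comm]
    exact (hg n).le

end Spectral

/-! ### Bounded measurable functions -/

section BoundedMeasurable

variable {E : Type*} [MeasurableSpace E] {d : ℕ}

theorem BM.ext {f g : BM E} (h : ∀ x, f.toFun x = g.toFun x) : f = g :=
  Subtype.ext (lp.ext (funext h))

theorem BM.norm_le {f : BM E} {C : ℝ} (hC : 0 ≤ C) (h : ∀ x, ‖f.toFun x‖ ≤ C) : ‖f‖ ≤ C :=
  lp.norm_le_of_forall_le hC h

theorem BM.sub_toFun (f g : BM E) (x : E) : (f - g).toFun x = f.toFun x - g.toFun x := rfl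

theorem BM.smul_toFun (c : ℂ) (f : BM E) (x : E) : (c • f).toFun x = c * f.toFun x := rfl

/-- The function `exp(i t · u)`. -/
def expInner (t : Vec d) {u : E → Vec d} (hu : Measurable u) : BM E :=
  BM.mk (fun x => Complex.exp ((inner ℝ t (u x) : ℝ) * Complex.I))
    (Complex.measurable_exp.comp ((Complex.measurable_ofReal.comp
      ((by fun_prop : Continuous fun v : Vec d => (inner ℝ t v : ℝ)).measurable.comp
        hu)).mul_const _)) 1 fun x => (Complex.norm_exp_ofReal_mul_I _).le

theorem expInner_toFun (t : Vec d) {u : E → Vec d} (hu : Measurable u) (x : E) :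
    (expInner t hu).toFun x = Complex.exp ((inner ℝ t (u x) : ℝ) * Complex.I) := rfl

end BoundedMeasurable

/-! ### Bounds for the Fourier operators -/

section FourierBounds

theorem pathIntegral_self {E Ω : Type*} [MetricSpace E] [MeasurableSpace E] [MeasurableSpace Ω]
    {d : ℕ} {M : MarkovFamily E Ω} {b : (unitInterval × E) →ᵇ Vec d} (α : unitInterval) (ω : Ω) :
    pathIntegral M b α α ω = ∫ s in (0 : ℝ)..1, b (α, M.X s.toNNReal ω) := by
  simp [pathIntegral, projIcc_val]
variable {E Ω : Type*} [MetricSpace E] [MeasurableSpace E] [BorelSpace E] [MeasurableSpace Ω]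
  {d : ℕ} {M : MarkovFamily E Ω} {ν : Measure E} {b : (unitInterval × E) →ᵇ Vec d}

/-- The phase `exp(i t · ∫_0^1 b(α, X_s) ds)`. -/
def phase (M : MarkovFamily E Ω) (b : (unitInterval × E) →ᵇ Vec d) (t : Vec d)
    (α : unitInterval) (ω : Ω) : ℂ :=
  Complex.exp (Complex.I * (inner ℝ t (pathIntegral M b α α ω) : ℝ))

theorem phase_eq {E Ω : Type*} [MetricSpace E] [MeasurableSpace E] [MeasurableSpace Ω]
    {d : ℕ} {M : MarkovFamily E Ω} {b : (unitInterval × E) →ᵇ Vec d} (t : Vec d) (α : unitInterval) (ω : Ω) :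
    phase M b t α ω = Complex.exp ((inner ℝ t (pathIntegral M b α α ω) : ℝ) * Complex.I) := by
  rw [phase, mul_comm]

theorem measurable_phase (t : Vec d) (α : unitInterval) : Measurable (phase M b t α) := by
  have h1 : Measurable fun ω => (inner ℝ t (pathIntegral M b α α ω) : ℝ) :=
    (by fun_prop : Continuous fun v : Vec d => (inner ℝ t v : ℝ)).measurable.comp
      (measurable_pathIntegral M b α α)
  exact Complex.measurable_exp.comp ((Complex.measurable_ofReal.comp h1).const_mul _)

theorem norm_phase {E Ω : Type*} [MetricSpace E] [MeasurableSpace E] [MeasurableSpace Ω]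
    {d : ℕ} {M : MarkovFamily E Ω} {b : (unitInterval × E) →ᵇ Vec d} (t : Vec d) (α : unitInterval) (ω : Ω) : ‖phase M b t α ω‖ = 1 := by
  rw [phase_eq, Complex.norm_exp_ofReal_mul_I]

theorem Q_toFun (t : Vec d) (α : unitInterval) (f : BM E) (x : E) :
    (Q M b t α α f).toFun x = ∫ ω, phase M b t α ω * f.toFun (M.X 1 ω) ∂(M.law x) :=
  rfl

theorem norm_Q_le (t : Vec d) (α : unitInterval) : ‖Q M b t α α‖ ≤ 1 :=
  LinearMap.mkContinuous_norm_le _ zero_le_one _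

theorem enorm_Q_le (t : Vec d) (α : unitInterval) (f : BM E) (x : E) :
    ‖(Q M b t α α f).toFun x‖ₑ ≤ ∫⁻ y, ‖f.toFun y‖ₑ ∂(M.transition 1 x) := by
  rw [Q_toFun, transition_apply, lintegral_map f.measurable.enorm (M.measurable_X 1)]
  refine (enorm_integral_le_lintegral_enorm _).trans (lintegral_mono fun ω => ?_)
  rw [enorm_mul, ← ofReal_norm (phase M b t α ω), norm_phase, ENNReal.ofReal_one, one_mul]

/-- The phases have modulus one, so iterates of `Q` are dominated by the transition semigroup. -/
theorem enorm_Q_iterate_le (t : Vec d) (α : unitInterval) (n : ℕ) (f : BM E) (x : E) :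
    ‖((Q M b t α α)^[n] f).toFun x‖ₑ ≤ ∫⁻ y, ‖f.toFun y‖ₑ ∂(M.transition n x) := by
  induction n generalizing x with
  | zero =>
    rw [Nat.cast_zero, transition_apply, lintegral_map f.measurable.enorm (M.measurable_X 0)]
    refine le_of_eq ?_
    rw [lintegral_congr_ae (g := fun _ => ‖f.toFun x‖ₑ)
      ((M.start x).mono fun ω h => by simp only [h])]
    simp
  | succ k ih =>
    rw [Function.iterate_succ_apply', Nat.cast_add_one, add_comm,
      lintegral_transition_add M 1 k x f.measurable.enorm]
    exact (enorm_Q_le t α _ x).trans (lintegral_mono ih)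

theorem Q_congr_ae (h : M.IsInvariant ν) (t : Vec d) (α : unitInterval) {f g : BM E}
    (hfg : f.toFun =ᵐ[ν] g.toFun) :
    (Q M b t α α f).toFun =ᵐ[ν] (Q M b t α α g).toFun := by
  filter_upwards [h.ae_transition 1 hfg] with x hx
  rw [transition_apply] at hx
  have h1 := ae_of_ae_map (M.measurable_X 1).aemeasurable hx
  rw [Q_toFun, Q_toFun]
  exact integral_congr_ae (h1.mono fun ω h2 => by simp only [h2])

end FourierBounds

/-! ### A lattice condition produces an eigenfunction of modulus one -/

section Eigenfunction

variable {E Ω : Type*} [MetricSpace E] [MeasurableSpace E] [BorelSpace E] [MeasurableSpace Ω]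
  {d : ℕ} {M : MarkovFamily E Ω} {ν : Measure E} {b : (unitInterval × E) →ᵇ Vec d}

/-- The eigenvalue equation holds only `ν`-a.e., so `f` need not be an eigenvector in sup norm.
Invariance lets the equation be iterated off null sets, and one good point for each `n` bounds `‖Q^n
f‖` below. -/
theorem one_le_spectralRadius_of_ae_eq (h : M.IsInvariant ν) (t : Vec d) (α : unitInterval)
    {f : BM E} (hf : ∀ x, ‖f.toFun x‖ = 1) {z : ℂ} (hz : ‖z‖ = 1)
    (hQ : (Q M b t α α f).toFun =ᵐ[ν] (z • f).toFun) :
    1 ≤ spectralRadius ℂ (Q M b t α α) := by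
  have := h.1
  have hpow : ∀ n : ℕ, ((Q M b t α α)^[n] f).toFun =ᵐ[ν] (z ^ n • f).toFun := fun n => by
    induction n with
    | zero => simp
    | succ k ih =>
      have h1 := Q_congr_ae (b := b) h t α ih
      rw [← Function.iterate_succ_apply' (Q M b t α α), map_smul] at h1
      filter_upwards [h1, hQ] with x h2 h3
      rw [h2, BM.smul_toFun, h3, BM.smul_toFun, BM.smul_toFun, pow_succ, mul_assoc]
  refine one_le_spectralRadius_of_le_norm_iterate (Q M b t α α)
    (BM.norm_le zero_le_one fun x => (hf x).le) fun n => ?_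
  obtain ⟨x, hx⟩ := (hpow n).exists
  refine le_trans (le_of_eq ?_) (BM.norm_apply_le _ x)
  rw [hx, BM.smul_toFun, norm_mul, norm_pow, hz, hf, one_pow, one_mul]

theorem NonArithmetic.nonLatticeCond (h : M.IsInvariant ν) (hna : NonArithmetic M b) :
    NonLatticeCond M ν b := by
  rintro α ⟨a, H, u, hH, hne, hu, -, hae⟩
  obtain ⟨t, ht0, ht⟩ := exists_inner_of_isClosed H hH hne
  -- The factor `2π` turns `t · h ∈ ℤ` into triviality of the character on `H`.
  have hπ : ((2 * Real.pi) • t) ≠ 0 := smul_ne_zero (by positivity) ht0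
  refine absurd (hna α _ hπ) (not_lt.2 ?_)
  obtain ⟨τ, hτ⟩ : ∃ τ, τ = (2 * Real.pi) • t := ⟨_, rfl⟩
  rw [← hτ]
  have hkey : ∀ᵐ ω ∂(M.lawFrom ν), phase M b τ α ω * (expInner τ hu).toFun (M.X 1 ω)
      = Complex.exp ((inner ℝ τ a : ℝ) * Complex.I) * (expInner τ hu).toFun (M.X 0 ω) := by
    filter_upwards [hae] with ω hω
    obtain ⟨y, hy, hω⟩ := hω
    obtain ⟨k, hk⟩ := ht y hy
    rw [phase_eq, expInner_toFun, expInner_toFun, ← Complex.exp_add, ← Complex.exp_add,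
      Complex.exp_eq_exp_iff_exists_int]
    refine ⟨k, ?_⟩
    rw [← pathIntegral_self, sub_eq_iff_eq_add] at hω
    have h1 := congrArg (fun v => (inner ℝ τ v : ℝ)) hω
    simp only [inner_add_right] at h1
    have h2 : (inner ℝ τ y : ℝ) = 2 * Real.pi * k := by
      rw [hτ, real_inner_smul_left, hk]
    rw [h2] at h1
    have h3 := congrArg (fun r : ℝ => (r : ℂ) * Complex.I) h1
    push_cast at h3
    linear_combination h3
  refine one_le_spectralRadius_of_ae_eq h τ α (f := expInner τ hu)
    (fun x => Complex.norm_exp_ofReal_mul_I _)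
    (z := Complex.exp ((inner ℝ τ a : ℝ) * Complex.I)) (Complex.norm_exp_ofReal_mul_I _) ?_
  have hm : MeasurableSet {ω | phase M b τ α ω * (expInner τ hu).toFun (M.X 1 ω)
      = Complex.exp ((inner ℝ τ a : ℝ) * Complex.I) * (expInner τ hu).toFun (M.X 0 ω)} :=
    measurableSet_eq_fun ((measurable_phase τ α).mul
      ((expInner τ hu).measurable.comp (M.measurable_X 1)))
      (((expInner τ hu).measurable.comp (M.measurable_X 0)).const_mul _)
  filter_upwards [(ae_lawFrom_iff hm).1 hkey] with x hx
  rw [Q_toFun, BM.smul_toFun, integral_congr_ae (g := fun _ =>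
    Complex.exp ((inner ℝ τ a : ℝ) * Complex.I) * (expInner τ hu).toFun x) ?_]
  · simp
  · filter_upwards [hx, M.start x] with ω h1 h2
    rw [h1, h2]

end Eigenfunction

/-! ### Weak convergence of approximate kernel elements -/

/-- Injectivity makes the range of the adjoint dense. On that range `⟨A* k, f_n⟩ = ⟨k, A f_n⟩ → 0`,
and boundedness of `f_n` extends this to all `g`. -/
theorem tendsto_inner_of_injective {H K : Type*} [NormedAddCommGroup H] [InnerProductSpace ℂ H]
    [CompleteSpace H] [NormedAddCommGroup K] [InnerProductSpace ℂ K] [CompleteSpace K]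
    (A : H →L[ℂ] K) (hA : ∀ f, A f = 0 → f = 0) {f : ℕ → H} (hf : ∀ n, ‖f n‖ ≤ 1)
    (hAf : Tendsto (fun n => ‖A (f n)‖) atTop (𝓝 0)) (g : H) :
    Tendsto (fun n => inner ℂ g (f n)) atTop (𝓝 0) := by
  have hdense : (A.adjoint).range.topologicalClosure = ⊤ := by
    rw [← ContinuousLinearMap.orthogonal_ker]
    have hk : A.ker = ⊥ := (Submodule.eq_bot_iff _).2 fun f hf => hA f hf
    rw [hk, Submodule.bot_orthogonal_eq_top]
  rw [Metric.tendsto_atTop]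
  intro ε hε
  have hg : g ∈ closure ((A.adjoint).range : Set H) := by
    rw [← Submodule.topologicalClosure_coe, hdense]
    trivial
  obtain ⟨_, ⟨k, rfl⟩, hk⟩ := Metric.mem_closure_iff.1 hg (ε / 2) (by positivity)
  have hlim : Tendsto (fun n => ‖k‖ * ‖A (f n)‖) atTop (𝓝 0) := by
    simpa using hAf.const_mul ‖k‖
  obtain ⟨n₀, hn₀⟩ := eventually_atTop.1 (hlim.eventually_lt_const
    (show 0 < ε / 2 by positivity))
  refine ⟨n₀, fun n hn => ?_⟩
  rw [dist_zero_right]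
  have h1 : inner ℂ g (f n) = inner ℂ (g - A.adjoint k) (f n) + inner ℂ k (A (f n)) := by
    rw [inner_sub_left, ContinuousLinearMap.adjoint_inner_left, sub_add_cancel]
  have hk' : ‖g - A.adjoint k‖ < ε / 2 := by rw [← dist_eq_norm]; exact hk
  rw [h1]
  calc ‖inner ℂ (g - A.adjoint k) (f n) + inner ℂ k (A (f n))‖
      ≤ ‖g - A.adjoint k‖ * ‖f n‖ + ‖k‖ * ‖A (f n)‖ :=
        (norm_add_le _ _).trans (add_le_add (norm_inner_le_norm _ _) (norm_inner_le_norm _ _))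
    _ ≤ ‖g - A.adjoint k‖ * 1 + ‖k‖ * ‖A (f n)‖ := by gcongr; exact hf n
    _ < ε := by linarith [hn₀ n hn]

/-! ### Bounded measurable functions as elements of `L²` -/

section L2

variable {E : Type*} [MeasurableSpace E]

theorem BM.memLp (ν : Measure E) [IsFiniteMeasure ν] (f : BM E) : MemLp f.toFun 2 ν :=
  MemLp.of_bound f.measurable.aestronglyMeasurable ‖f‖ (Eventually.of_forall f.norm_apply_le)

/-- The class of a bounded measurable function in `L²`. -/
def toL2 (ν : Measure E) [IsFiniteMeasure ν] : BM E →ₗ[ℂ] Lp ℂ 2 ν where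
  toFun f := (f.memLp ν).toLp f.toFun
  map_add' _ _ := rfl
  map_smul' _ _ := rfl

theorem coeFn_toL2 (ν : Measure E) [IsFiniteMeasure ν] (f : BM E) :
    toL2 ν f =ᵐ[ν] f.toFun := (f.memLp ν).coeFn_toLp

theorem norm_toL2_le (ν : Measure E) [IsProbabilityMeasure ν] (f : BM E) :
    ‖toL2 ν f‖ ≤ ‖f‖ := by
  have h := Lp.norm_le_of_ae_bound (f := toL2 ν f) (p := 2) (norm_nonneg f)
    ((coeFn_toL2 ν f).mono fun x hx => by rw [hx]; exact f.norm_apply_le x)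
  have h1 : measureUnivNNReal ν = 1 := by simp [measureUnivNNReal]
  simpa [h1] using h

theorem denseRange_toL2 {E : Type*} [MetricSpace E] [MeasurableSpace E] [BorelSpace E]
    (ν : Measure E) [IsFiniteMeasure ν] : DenseRange (toL2 ν) := by
  refine (BoundedContinuousFunction.toLp_denseRange (p := 2) ℂ ν ℂ (by simp)).mono ?_
  rintro _ ⟨f, rfl⟩
  refine ⟨BM.mk f f.continuous.measurable ‖f‖ f.norm_coe_le_norm, ?_⟩
  refine Lp.ext ((coeFn_toL2 ν _).trans ?_)
  exact (BoundedContinuousFunction.coeFn_toLp 2 ν ℂ f).symm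

/-- Multiplication by the indicator of a measurable set. -/
def indicatorBM {G : Set E} (hG : MeasurableSet G) : BM E →ₗ[ℂ] BM E where
  toFun f := BM.mk (G.indicator f.toFun) (f.measurable.indicator hG) ‖f‖ fun x =>
    (norm_indicator_le_norm_self _ _).trans (f.norm_apply_le x)
  map_add' f g := BM.ext fun x => congrFun (indicator_add G f.toFun g.toFun) x
  map_smul' c f := BM.ext fun x => congrFun (indicator_const_smul G c f.toFun) x

theorem lintegral_enorm_le_toL2 (ν : Measure E) [IsProbabilityMeasure ν] (f : BM E) :
    ∫⁻ x, ‖f.toFun x‖ₑ ∂ν ≤ ‖toL2 ν f‖ₑ := by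
  have h1 := eLpNorm_le_eLpNorm_of_exponent_le (μ := ν) (p := 1) (q := 2) (by norm_num)
    f.measurable.aestronglyMeasurable
  rw [eLpNorm_one_eq_lintegral_enorm] at h1
  refine h1.trans (le_of_eq ?_)
  rw [Lp.enorm_def]
  exact (eLpNorm_congr_ae (coeFn_toL2 ν f)).symm

/-- A functional on bounded measurable functions dominated by a measure is weakly `L²(ν)`-continuous
when localized to a set on which the measure has a bounded density with respect to `ν`. -/
theorem tendsto_functional_indicator {E : Type*} [MetricSpace E] [MeasurableSpace E]
    [BorelSpace E] {μ ν : Measure E} [IsProbabilityMeasure ν] {Λ : BM E →ₗ[ℂ] ℂ}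
    (hΛ : ∀ f, ‖Λ f‖ₑ ≤ ∫⁻ y, ‖f.toFun y‖ₑ ∂μ) {G : Set E} (hG : MeasurableSet G) {C : ℝ≥0}
    (hC : μ.restrict G ≤ (C : ℝ≥0∞) • ν) {f : ℕ → BM E}
    (hf : ∀ g : Lp ℂ 2 ν, Tendsto (fun n => inner ℂ g (toL2 ν (f n))) atTop (𝓝 0)) :
    Tendsto (fun n => Λ (indicatorBM hG (f n))) atTop (𝓝 0) := by
  have hbd : ∀ f, ‖(Λ.comp (indicatorBM hG)) f‖ ≤ C * ‖toL2 ν f‖ := fun f => by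
    have h1 : ‖Λ (indicatorBM hG f)‖ₑ ≤ C * ‖toL2 ν f‖ₑ := by
      calc ‖Λ (indicatorBM hG f)‖ₑ ≤ ∫⁻ y, ‖G.indicator f.toFun y‖ₑ ∂μ := hΛ _
        _ = ∫⁻ y in G, ‖f.toFun y‖ₑ ∂μ := by
          rw [← lintegral_indicator hG]
          exact lintegral_congr fun y => enorm_indicator_eq_indicator_enorm _ _
        _ ≤ ∫⁻ y, ‖f.toFun y‖ₑ ∂((C : ℝ≥0∞) • ν) := lintegral_mono' hC le_rfl
        _ = C * ∫⁻ y, ‖f.toFun y‖ₑ ∂ν := lintegral_smul_measure _ _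
        _ ≤ C * ‖toL2 ν f‖ₑ := by gcongr; exact lintegral_enorm_le_toL2 ν f
    simp only [enorm_eq_nnnorm] at h1
    exact_mod_cast h1
  -- The `L²` bound extends the localized functional to all of `L²(ν)`, where Riesz representation
  -- makes it an inner product.
  have heq := LinearMap.extendOfNorm_eq (f := Λ.comp (indicatorBM hG)) (denseRange_toL2 ν)
    ⟨C, hbd⟩
  obtain ⟨Φ, hΦ⟩ : ∃ Φ : Lp ℂ 2 ν →L[ℂ] ℂ, Φ = (Λ.comp (indicatorBM hG)).extendOfNorm (toL2 ν) :=
    ⟨_, rfl⟩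
  rw [← hΦ] at heq
  refine (hf ((InnerProductSpace.toDual ℂ _).symm Φ)).congr fun n => ?_
  rw [InnerProductSpace.toDual_symm_apply, heq]
  rfl

/-- Hahn decomposition of `(2/δ) ν - μ`. On the negative part `(2/δ) ν(Gᶜ) ≤ μ(Gᶜ) ≤ 1`, so `ν(Gᶜ) ≤
δ/2`, and the total variation bound adds `1 - δ`. -/
theorem exists_restrict_le {μ ν : Measure E} [IsProbabilityMeasure μ] [IsProbabilityMeasure ν]
    {δ : ℝ} (hδ : 0 < δ) (h : ∀ A, MeasurableSet A → |μ.real A - ν.real A| ≤ 1 - δ) :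
    ∃ G, MeasurableSet G ∧ μ.restrict G ≤ ((2 / δ).toNNReal : ℝ≥0∞) • ν ∧
      μ Gᶜ ≤ ENNReal.ofReal (1 - δ / 2) := by
  obtain ⟨G, hG, h1, h2⟩ := hahn_decomposition ((2 / δ).toNNReal • ν) μ
  refine ⟨G, hG, Measure.le_iff.2 fun s hs => ?_, ?_⟩
  · rw [Measure.restrict_apply hs]
    refine (h1 _ (hs.inter hG) inter_subset_right).trans ?_
    exact measure_mono inter_subset_left
  · have h3 := h2 _ hG.compl le_rfl
    have h4 := h Gᶜ hG.compl
    have h5 : 2 / δ * ν.real Gᶜ ≤ μ.real Gᶜ := by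
      have := ENNReal.toReal_mono (measure_ne_top _ _) h3
      rw [Measure.smul_apply, ENNReal.toReal_smul, NNReal.smul_def,
        Real.coe_toNNReal _ (by positivity)] at this
      exact this
    have h6 := measureReal_le_one (μ := μ) (s := Gᶜ)
    have h7 : ν.real Gᶜ ≤ δ / 2 := by
      have h8 : 2 / δ * ν.real Gᶜ ≤ 1 := h5.trans h6
      rw [div_mul_eq_mul_div, div_le_one hδ] at h8
      linarith
    rw [← ofReal_measureReal]
    refine ENNReal.ofReal_le_ofReal ?_
    linarith [(abs_le.1 h4).2]

end L2

/-! ### From approximate eigenvectors to eigenfunctions -/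

theorem memLp_unit_mul {Ω : Type*} [MeasurableSpace Ω] (P : Measure Ω) {φ : Ω → ℂ}
    (hm : Measurable φ) (hφ : ∀ ω, ‖φ ω‖ = 1) (f : Lp ℂ 2 P) :
    MemLp (fun ω => φ ω * f ω) 2 P :=
  (Lp.memLp f).of_le (hm.aestronglyMeasurable.mul (Lp.aestronglyMeasurable f))
    (Eventually.of_forall fun ω => by rw [norm_mul, hφ, one_mul])

/-- Multiplication by a function of modulus `1` on `L²`. -/
def mulUnit {Ω : Type*} [MeasurableSpace Ω] (P : Measure Ω) {φ : Ω → ℂ} (hm : Measurable φ)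
    (hφ : ∀ ω, ‖φ ω‖ = 1) : Lp ℂ 2 P →L[ℂ] Lp ℂ 2 P :=
  LinearMap.mkContinuous
    { toFun := fun f => (memLp_unit_mul P hm hφ f).toLp _
      map_add' := fun f g => by
        rw [← MemLp.toLp_add, MemLp.toLp_eq_toLp_iff]
        filter_upwards [Lp.coeFn_add f g] with ω h
        rw [h, Pi.add_apply, mul_add, Pi.add_apply]
      map_smul' := fun c f => by
        rw [RingHom.id_apply, ← MemLp.toLp_const_smul, MemLp.toLp_eq_toLp_iff]
        filter_upwards [Lp.coeFn_smul c f] with ω h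
        rw [h, Pi.smul_apply, Pi.smul_apply, smul_eq_mul, smul_eq_mul, mul_left_comm] }
    1 fun f => by
      rw [one_mul]
      refine Lp.norm_le_norm_of_ae_le ((memLp_unit_mul P hm hφ f).coeFn_toLp.mono fun ω h => ?_)
      change ‖(memLp_unit_mul P hm hφ f).toLp _ ω‖ ≤ _
      rw [h, norm_mul, hφ, one_mul]

theorem coeFn_mulUnit {Ω : Type*} [MeasurableSpace Ω] (P : Measure Ω) {φ : Ω → ℂ}
    (hm : Measurable φ) (hφ : ∀ ω, ‖φ ω‖ = 1) (f : Lp ℂ 2 P) :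
    mulUnit P hm hφ f =ᵐ[P] fun ω => φ ω * f ω := (memLp_unit_mul P hm hφ f).coeFn_toLp

theorem norm_mulUnit_le {Ω : Type*} [MeasurableSpace Ω] (P : Measure Ω) {φ : Ω → ℂ}
    (hm : Measurable φ) (hφ : ∀ ω, ‖φ ω‖ = 1) (f : Lp ℂ 2 P) : ‖mulUnit P hm hφ f‖ ≤ ‖f‖ := by
  refine Lp.norm_le_norm_of_ae_le ((coeFn_mulUnit P hm hφ f).mono fun ω h => ?_)
  rw [h, norm_mul, hφ, one_mul]

section Eval

variable {E Ω : Type*} [MetricSpace E] [MeasurableSpace E] [MeasurableSpace Ω]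
  {M : MarkovFamily E Ω} {ν : Measure E}

/-- The isometry `f ↦ f(X_s)` from `L²(ν)` to `L²(P_ν)`. -/
def evalL2 (h : M.IsInvariant ν) (s : ℝ≥0) : Lp ℂ 2 ν →ₗᵢ[ℂ] Lp ℂ 2 (M.lawFrom ν) :=
  Lp.compMeasurePreservingₗᵢ ℂ (M.X s) (h.measurePreserving_X s)

theorem coeFn_evalL2 (h : M.IsInvariant ν) (s : ℝ≥0) (f : Lp ℂ 2 ν) :
    evalL2 h s f =ᵐ[M.lawFrom ν] fun ω => f (M.X s ω) :=
  Lp.coeFn_compMeasurePreserving f (h.measurePreserving_X s)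

theorem coeFn_evalL2_toL2 [IsProbabilityMeasure ν] (h : M.IsInvariant ν) (s : ℝ≥0) (f : BM E) :
    evalL2 h s (toL2 ν f) =ᵐ[M.lawFrom ν] fun ω => f.toFun (M.X s ω) := by
  filter_upwards [coeFn_evalL2 h s (toL2 ν f),
    (h.measurePreserving_X s).quasiMeasurePreserving.ae (coeFn_toL2 ν f)] with ω h1 h2
  rw [h1, h2]

theorem integral_lawFrom {g : Ω → ℂ} (hg : Integrable g (M.lawFrom ν)) :
    ∫ ω, g ω ∂(M.lawFrom ν) = ∫ x, ∫ ω, g ω ∂(M.law x) ∂ν := by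
  have e : (M.law ∘ₖ Kernel.const Unit ν) () = M.lawFrom ν := by
    rw [Kernel.comp_apply, Kernel.const_apply, MarkovFamily.lawFrom]
  rw [← e] at hg ⊢
  rw [Kernel.integral_comp hg, Kernel.const_apply]

end Eval

section Operator

variable {E Ω : Type*} [MetricSpace E] [MeasurableSpace E] [BorelSpace E] [MeasurableSpace Ω]
  {d : ℕ} {M : MarkovFamily E Ω} {ν : Measure E} (b : (unitInterval × E) →ᵇ Vec d)

/-- The operator `f ↦ exp(i t · ∫_0^1 b(α, X_s) ds) f(X_1)` from `L²(ν)` to `L²(P_ν)`. -/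
def twistL2 (h : M.IsInvariant ν) (t : Vec d) (α : unitInterval) :
    Lp ℂ 2 ν →L[ℂ] Lp ℂ 2 (M.lawFrom ν) :=
  (mulUnit (M.lawFrom ν) (measurable_phase (M := M) (b := b) t α) (norm_phase t α)).comp
    (evalL2 h 1).toContinuousLinearMap

theorem coeFn_twistL2 (h : M.IsInvariant ν) (t : Vec d) (α : unitInterval) (f : Lp ℂ 2 ν) :
    twistL2 b h t α f =ᵐ[M.lawFrom ν] fun ω => phase M b t α ω * f (M.X 1 ω) := by
  filter_upwards [coeFn_mulUnit (M.lawFrom ν) (measurable_phase (M := M) (b := b) t α) (norm_phase t α)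
    (evalL2 h 1 f), coeFn_evalL2 h 1 f] with ω h1 h2
  rw [← h2]
  exact h1

theorem norm_twistL2_le (h : M.IsInvariant ν) (t : Vec d) (α : unitInterval) (f : Lp ℂ 2 ν) :
    ‖twistL2 b h t α f‖ ≤ ‖f‖ :=
  (norm_mulUnit_le (M.lawFrom ν) (measurable_phase (M := M) (b := b) t α) (norm_phase t α)
    (evalL2 h 1 f)).trans ((evalL2 h 1).norm_map f).le

/-- Disintegration over the starting point: `Q` is the compression of the twisted evaluation at time
`1` to functions of `X_0`. -/
theorem inner_evalL2_twistL2 [IsProbabilityMeasure ν] (h : M.IsInvariant ν) (t : Vec d)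
    (α : unitInterval) (f g : BM E) :
    inner ℂ (evalL2 h 0 (toL2 ν g)) (twistL2 b h t α (toL2 ν f))
      = inner ℂ (toL2 ν g) (toL2 ν (Q M b t α α f)) := by
  rw [L2.inner_def, L2.inner_def]
  have hm : Measurable fun ω => (starRingEnd ℂ) (g.toFun (M.X 0 ω))
      * (phase M b t α ω * f.toFun (M.X 1 ω)) :=
    (Complex.continuous_conj.measurable.comp (g.measurable.comp (M.measurable_X 0))).mul
      ((measurable_phase t α).mul (f.measurable.comp (M.measurable_X 1)))
  have hi : Integrable (fun ω => (starRingEnd ℂ) (g.toFun (M.X 0 ω))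
      * (phase M b t α ω * f.toFun (M.X 1 ω))) (M.lawFrom ν) := by
    refine Integrable.of_bound hm.aestronglyMeasurable (‖g‖ * ‖f‖)
      (Eventually.of_forall fun ω => ?_)
    rw [norm_mul, norm_mul, norm_phase, one_mul, RCLike.norm_conj]
    exact mul_le_mul (g.norm_apply_le _) (f.norm_apply_le _) (norm_nonneg _) (norm_nonneg _)
  calc ∫ ω, inner ℂ (evalL2 h 0 (toL2 ν g) ω) (twistL2 b h t α (toL2 ν f) ω) ∂(M.lawFrom ν)
      = ∫ ω, (starRingEnd ℂ) (g.toFun (M.X 0 ω)) * (phase M b t α ω * f.toFun (M.X 1 ω))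
          ∂(M.lawFrom ν) := by
        refine integral_congr_ae ?_
        filter_upwards [coeFn_evalL2_toL2 h 0 g, coeFn_twistL2 b h t α (toL2 ν f),
          (h.measurePreserving_X 1).quasiMeasurePreserving.ae (coeFn_toL2 ν f)] with ω h1 h2 h3
        rw [h1, h2, h3, RCLike.inner_apply, mul_comm]
    _ = ∫ x, ∫ ω, (starRingEnd ℂ) (g.toFun (M.X 0 ω)) * (phase M b t α ω * f.toFun (M.X 1 ω))
          ∂(M.law x) ∂ν := integral_lawFrom hi
    _ = ∫ x, inner ℂ (toL2 ν g x) (toL2 ν (Q M b t α α f) x) ∂ν := by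
        refine integral_congr_ae ?_
        filter_upwards [coeFn_toL2 ν g, coeFn_toL2 ν (Q M b t α α f)] with x h1 h2
        rw [h1, h2, RCLike.inner_apply, mul_comm, Q_toFun, ← integral_const_mul]
        refine integral_congr_ae ((M.start x).mono fun ω h3 => ?_)
        simp only [h3]

/-- Both terms have `L²` norm at most that of `f`, so expanding the square leaves at most `-2 Re ⟨z
f, Q f - z f⟩`. -/
theorem norm_twistL2_sub_sq_le [IsProbabilityMeasure ν] (h : M.IsInvariant ν) (t : Vec d)
    (α : unitInterval) {z : ℂ} (hz : ‖z‖ = 1) (f : BM E) :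
    ‖twistL2 b h t α (toL2 ν f) - z • evalL2 h 0 (toL2 ν f)‖ ^ 2
      ≤ 2 * (‖f‖ * ‖Q M b t α α f - z • f‖) := by
  rw [norm_sub_sq (𝕜 := ℂ), norm_smul, hz, one_mul, LinearIsometry.norm_map]
  have h1 := pow_le_pow_left₀ (norm_nonneg _) (norm_twistL2_le b h t α (toL2 ν f)) 2
  have h2 : inner ℂ (z • evalL2 h 0 (toL2 ν f)) (twistL2 b h t α (toL2 ν f))
      = inner ℂ (toL2 ν (z • f)) (toL2 ν (Q M b t α α f)) := by
    rw [← map_smul, ← map_smul (toL2 ν), inner_evalL2_twistL2]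
  have h3 : RCLike.re (inner ℂ (twistL2 b h t α (toL2 ν f)) (z • evalL2 h 0 (toL2 ν f)))
      = RCLike.re (inner ℂ (toL2 ν (z • f)) (toL2 ν (Q M b t α α f - z • f)))
        + ‖toL2 ν f‖ ^ 2 := by
    rw [inner_re_symm, h2, map_sub (toL2 ν), inner_sub_right, map_sub,
      inner_self_eq_norm_sq (𝕜 := ℂ), map_smul, norm_smul, hz, one_mul]
    ring
  have h4 : ‖inner ℂ (toL2 ν (z • f)) (toL2 ν (Q M b t α α f - z • f))‖
      ≤ ‖f‖ * ‖Q M b t α α f - z • f‖ := by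
    refine (norm_inner_le_norm _ _).trans ?_
    rw [map_smul, norm_smul, hz, one_mul]
    exact mul_le_mul (norm_toL2_le ν _) (norm_toL2_le ν _) (norm_nonneg _) (norm_nonneg _)
  have h5 := (abs_le.1 ((Complex.abs_re_le_norm _).trans h4)).1
  rw [h3]
  change _ ≤ (RCLike.re (K := ℂ) _ : ℝ) at h5
  linarith

/-- The value of an iterate of the Fourier operator at a point, as a functional. -/
def iterateFunctional (M : MarkovFamily E Ω) (t : Vec d) (α : unitInterval) (N : ℕ) (x : E) :
    BM E →ₗ[ℂ] ℂ where
  toFun f := ((Q M b t α α)^[N] f).toFun x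
  map_add' f g := by rw [iterate_map_add]; rfl
  map_smul' c f := by
    have : (Q M b t α α)^[N] (c • f) = c • (Q M b t α α)^[N] f :=
      (Function.Commute.iterate_left (f := Q M b t α α) (g := fun f => c • f)
        (fun f => map_smul _ c f) N) f
    rw [this]; rfl

/-- Approximate eigenvectors of the Fourier operator do not converge weakly to `0` in `L²(ν)`. -/
theorem not_tendsto_inner_zero [IsProbabilityMeasure ν] {N : ℕ} {δ : ℝ} (hδ0 : 0 < δ)
    (hδ : ∀ (x : E) (A : Set E), MeasurableSet A →
      |(M.transition N x).real A - ν.real A| ≤ 1 - δ) (t : Vec d) (α : unitInterval)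
    {z : ℂ} (hz : ‖z‖ = 1) {f : ℕ → BM E} (hf1 : ∀ n, ‖f n‖ = 1)
    (hf : Tendsto (fun n => ‖Q M b t α α (f n) - z • f n‖) atTop (𝓝 0))
    (hweak : ∀ g : Lp ℂ 2 ν, Tendsto (fun n => inner ℂ g (toL2 ν (f n))) atTop (𝓝 0)) :
    False := by
  -- The bound for the empty set reads `0 ≤ 1 - δ`.
  have hδ1 : δ ≤ 1 := by
    obtain ⟨x⟩ : Nonempty E := nonempty_of_isProbabilityMeasure ν
    have := (abs_nonneg _).trans (hδ x ∅ .empty)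
    linarith
  obtain ⟨e, he⟩ : ∃ e : ℕ → ℝ≥0∞,
    e = fun n => ENNReal.ofReal ‖(Q M b t α α)^[N] (f n) - z ^ N • f n‖ := ⟨_, rfl⟩
  have hetend : Tendsto e atTop (𝓝 0) := by
    have := ENNReal.tendsto_ofReal (tendsto_iterate_sub (Q M b t α α) z hf N)
    rwa [ENNReal.ofReal_zero, ← he] at this
  obtain ⟨C, hC⟩ : ∃ C : ℝ≥0, C = (2 / δ).toNNReal := ⟨_, rfl⟩
  obtain ⟨ρ, hρ⟩ : ∃ ρ : ℝ≥0∞, ρ = ENNReal.ofReal (1 - δ / 2) := ⟨_, rfl⟩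
  have hf1' : ∀ n y, ‖(f n).toFun y‖ₑ ≤ 1 := fun n y => by
    rw [← ofReal_norm, ← ENNReal.ofReal_one, ← hf1 n]
    exact ENNReal.ofReal_le_ofReal ((f n).norm_apply_le y)
  choose G hG hGC hGρ using fun x => exists_restrict_le hδ0 (hδ x)
  rw [← hC] at hGC
  rw [← hρ] at hGρ
  have hΛ : ∀ x g, ‖iterateFunctional b M t α N x g‖ₑ
      ≤ ∫⁻ y, ‖g.toFun y‖ₑ ∂(M.transition N x) := fun x g => enorm_Q_iterate_le t α N g x
  have hpt : ∀ x n, ‖(f n).toFun x‖ₑ ≤ ‖iterateFunctional b M t α N x (f n)‖ₑ + e n :=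
    fun x n => by
      have h1 : ‖(f n).toFun x‖ₑ = ‖(z ^ N • f n).toFun x‖ₑ := by
        rw [BM.smul_toFun, enorm_mul, enorm_pow, ← ofReal_norm z, hz]
        simp
      have h2 : (z ^ N • f n).toFun x = iterateFunctional b M t α N x (f n)
          - ((Q M b t α α)^[N] (f n) - z ^ N • f n).toFun x := by
        rw [BM.sub_toFun]
        exact (sub_sub_cancel _ _).symm
      rw [h1, h2]
      refine enorm_sub_le.trans ?_
      gcongr
      rw [he, ← ofReal_norm]
      exact ENNReal.ofReal_le_ofReal (BM.norm_apply_le _ x)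
  have hsplit : ∀ x n, ‖(f n).toFun x‖ₑ ≤
      ‖iterateFunctional b M t α N x (indicatorBM (hG x) (f n))‖ₑ
        + ∫⁻ y in (G x)ᶜ, ‖(f n).toFun y‖ₑ ∂(M.transition N x) + e n := fun x n => by
    refine (hpt x n).trans ?_
    gcongr
    have h1 : f n = indicatorBM (hG x) (f n) + indicatorBM (hG x).compl (f n) :=
      BM.ext fun y => (congrFun (indicator_self_add_compl (G x) (f n).toFun) y).symm
    conv_lhs => rw [h1, map_add]
    refine (enorm_add_le _ _).trans ?_
    gcongr
    refine (hΛ x _).trans (le_of_eq ?_)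
    rw [← lintegral_indicator (hG x).compl]
    exact lintegral_congr fun y => enorm_indicator_eq_indicator_enorm _ _
  have hloc : ∀ x, Tendsto (fun n =>
      ‖iterateFunctional b M t α N x (indicatorBM (hG x) (f n))‖ₑ) atTop (𝓝 0) := fun x => by
    simpa using (tendsto_functional_indicator (hΛ x) (hG x) (hGC x) hweak).enorm
  -- The part over `G x` vanishes by weak convergence; the rest has mass at most `ρ` and is handled
  -- by the reverse Fatou lemma. As `ρ < 1`, the supremum of these upper limits must be zero.
  have hlimsup : ∀ x, limsup (fun n => ‖(f n).toFun x‖ₑ) atTop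
      ≤ (⨆ y, limsup (fun n => ‖(f n).toFun y‖ₑ) atTop) * ρ := fun x => by
    calc limsup (fun n => ‖(f n).toFun x‖ₑ) atTop
        ≤ limsup (fun n => ∫⁻ y in (G x)ᶜ, ‖(f n).toFun y‖ₑ ∂(M.transition N x)) atTop := by
          refine (limsup_le_limsup (Eventually.of_forall (hsplit x))).trans (le_of_eq ?_)
          refine (ENNReal.limsup_add_of_right_tendsto_zero hetend _).trans ?_
          exact ENNReal.limsup_add_of_left_tendsto_zero (hloc x) _
      _ ≤ ∫⁻ y in (G x)ᶜ, limsup (fun n => ‖(f n).toFun y‖ₑ) atTop ∂(M.transition N x) :=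
          limsup_lintegral_le 1 (fun n => (f n).measurable.enorm)
            (fun n => Eventually.of_forall (hf1' n)) (by simp)
      _ ≤ ∫⁻ y in (G x)ᶜ, (⨆ y, limsup (fun n => ‖(f n).toFun y‖ₑ) atTop)
            ∂(M.transition N x) :=
          lintegral_mono fun y => le_iSup (fun y => limsup (fun n => ‖(f n).toFun y‖ₑ) atTop) y
      _ ≤ (⨆ y, limsup (fun n => ‖(f n).toFun y‖ₑ) atTop) * ρ := by
          rw [setLIntegral_const]
          gcongr
          exact hGρ x
  have hzero : (⨆ y, limsup (fun n => ‖(f n).toFun y‖ₑ) atTop) = 0 := by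
    have h1 := iSup_le hlimsup
    have h2 : (⨆ y, limsup (fun n => ‖(f n).toFun y‖ₑ) atTop) ≤ 1 :=
      iSup_le fun y => limsup_le_of_le (h := Eventually.of_forall fun n => hf1' n y)
    by_contra hne
    have h3 : ρ < 1 := by
      rw [hρ]
      exact ENNReal.ofReal_lt_one.2 (by linarith)
    have h4 := ENNReal.mul_lt_mul_right hne (h2.trans_lt ENNReal.one_lt_top).ne h3
    rw [mul_one] at h4
    exact absurd h1 (not_le.2 h4)
  have hint : Tendsto (fun n => ∫⁻ y, ‖(f n).toFun y‖ₑ ∂ν) atTop (𝓝 0) := by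
    refine tendsto_of_le_liminf_of_limsup_le bot_le ?_
    refine (limsup_lintegral_le 1 (fun n => (f n).measurable.enorm)
      (fun n => Eventually.of_forall (hf1' n)) (by simp)).trans ?_
    have : ∀ y, limsup (fun n => ‖(f n).toFun y‖ₑ) atTop = 0 := fun y =>
      le_antisymm ((le_iSup (fun y => limsup (fun n => ‖(f n).toFun y‖ₑ) atTop) y).trans
        hzero.le) bot_le
    simp [this]
  -- Weak convergence is not uniform in `x`, but the `L¹(ν)` norm gives a bound independent of `x`.
  have hunif : ∀ x n, ‖(f n).toFun x‖ₑ ≤ C * ∫⁻ y, ‖(f n).toFun y‖ₑ ∂ν + ρ + e n :=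
    fun x n => by
      refine (hpt x n).trans ?_
      gcongr
      refine (hΛ x (f n)).trans ?_
      rw [← lintegral_add_compl _ (hG x)]
      gcongr
      · refine (lintegral_mono' (hGC x) le_rfl).trans (le_of_eq ?_)
        exact lintegral_smul_measure _ _
      · refine (setLIntegral_mono' (hG x).compl fun y _ => hf1' n y).trans ?_
        rw [setLIntegral_const, one_mul]
        exact hGρ x
  have hsmall : Tendsto (fun n => C * ∫⁻ y, ‖(f n).toFun y‖ₑ ∂ν + e n) atTop (𝓝 0) := by
    simpa using (ENNReal.Tendsto.const_mul hint (Or.inr ENNReal.coe_ne_top)).add hetend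
  -- With `ρ = 1 - δ/2`, an error of `δ/4` keeps the norm at most `1 - δ/4`.
  obtain ⟨n, hn⟩ := (hsmall.eventually_lt_const
    (show (0 : ℝ≥0∞) < ENNReal.ofReal (δ / 4) by simpa using by positivity)).exists
  have hle : ‖f n‖ ≤ 1 - δ / 4 := by
    refine BM.norm_le (by linarith) fun x => ?_
    have h1 : ‖(f n).toFun x‖ₑ ≤ ENNReal.ofReal (1 - δ / 4) := by
      refine (hunif x n).trans ?_
      rw [add_right_comm, hρ]
      refine (add_le_add_left hn.le _).trans (le_of_eq ?_)
      rw [← ENNReal.ofReal_add (by positivity) (by linarith)]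
      congr 1
      ring
    rw [← ofReal_norm] at h1
    exact (ENNReal.ofReal_le_ofReal_iff (by linarith)).1 h1
  rw [hf1 n] at hle
  linarith

end Operator

/-! ### The non-lattice condition implies the non-arithmetic condition -/

section NonArithmetic

variable {E Ω : Type*} [MetricSpace E] [MeasurableSpace E] [BorelSpace E] [MeasurableSpace Ω]
  {d : ℕ} {M : MarkovFamily E Ω} {ν : Measure E} {b : (unitInterval × E) →ᵇ Vec d}

/-- The closed subgroup of vectors `v` with `exp(i t · v) = 1`. -/
def characterKernel (t : Vec d) : AddSubgroup (Vec d) where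
  carrier := {v | Complex.exp ((inner ℝ t v : ℝ) * Complex.I) = 1}
  add_mem' {v w} hv hw := by
    rw [mem_ofPred_eq] at hv hw ⊢
    rw [inner_add_right, Complex.ofReal_add, add_mul, Complex.exp_add, hv, hw, one_mul]
  zero_mem' := by simp
  neg_mem' {v} hv := by
    rw [mem_ofPred_eq] at hv ⊢
    rw [inner_neg_right, Complex.ofReal_neg, neg_mul, Complex.exp_neg, hv, inv_one]

theorem mem_characterKernel {t v : Vec d} :
    v ∈ characterKernel t ↔ Complex.exp ((inner ℝ t v : ℝ) * Complex.I) = 1 := Iff.rfl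

theorem isClosed_characterKernel (t : Vec d) : IsClosed (characterKernel t : Set (Vec d)) :=
  isClosed_eq (by fun_prop) continuous_const

theorem inner_div_smul {t : Vec d} (ht : t ≠ 0) (r : ℝ) :
    (inner ℝ t ((r / ‖t‖ ^ 2) • t) : ℝ) = r := by
  rw [real_inner_smul_right, real_inner_self_eq_norm_sq,
    div_mul_cancel₀ _ (pow_ne_zero 2 (norm_ne_zero_iff.2 ht))]

theorem characterKernel_ne_top {t : Vec d} (ht : t ≠ 0) : characterKernel t ≠ ⊤ := by
  intro htop
  -- At this vector the character takes the value `-1`.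
  have h : (Real.pi / ‖t‖ ^ 2) • t ∈ characterKernel t := htop ▸ AddSubgroup.mem_top _
  rw [mem_characterKernel, inner_div_smul ht, Complex.exp_pi_mul_I] at h
  norm_num at h

/-- A solution of the eigenvalue equation along the stationary process, which does not vanish
almost everywhere, contradicts the non-lattice condition. -/
theorem NonLatticeCond.ae_eq_zero (hM : Mixing M ν) (hnl : NonLatticeCond M ν b) {t : Vec d}
    (ht : t ≠ 0) (α : unitInterval) {z : ℂ} {g : E → ℂ} (hz : ‖z‖ = 1) (hg : Measurable g)
    (hae : ∀ᵐ ω ∂(M.lawFrom ν), phase M b t α ω * g (M.X 1 ω) = z * g (M.X 0 ω)) :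
    g =ᵐ[ν] 0 := by
  by_contra hne
  have hS : MeasurableSet {x | g x ≠ 0} := hg (measurableSet_singleton 0).compl
  -- The phase and `z` have modulus one, so `|g|` is conserved from time `0` to time `1`.
  have hinv : M.InvariantSet ν 1 {x | g x ≠ 0} := by
    filter_upwards [hae] with ω h1
    have h2 := congrArg norm h1
    rw [norm_mul, norm_mul, norm_phase, hz, one_mul, one_mul] at h2
    change g _ ≠ 0 ↔ g _ ≠ 0
    rw [← norm_ne_zero_iff, ← norm_ne_zero_iff (a := g (M.X 1 ω)), h2]
  have hfull := hM.measure_compl_eq_zero_of_one hS hinv hne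
  have hne0 : ∀ᵐ x ∂ν, g x ≠ 0 := hfull
  -- Multiples of `t` are chosen so that their inner products with `t` are `arg z` and `arg g`; the
  -- relation modulo `characterKernel t` is then the eigenvalue equation divided by the common
  -- modulus.
  refine hnl α ⟨(z.arg / ‖t‖ ^ 2) • t, characterKernel t, fun x => ((g x).arg / ‖t‖ ^ 2) • t,
    isClosed_characterKernel t, characterKernel_ne_top ht,
    ((Complex.measurable_arg.comp hg).div_const _).smul_const t,
    ⟨Real.pi / ‖t‖ ^ 2 * ‖t‖, fun x => ?_⟩, ?_⟩
  · rw [norm_smul, Real.norm_eq_abs, abs_div, abs_of_nonneg (sq_nonneg ‖t‖)]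
    gcongr
    exact Complex.abs_arg_le_pi _
  · filter_upwards [hae, (hM.1.1.measurePreserving_X 0).quasiMeasurePreserving.ae hne0]
      with ω h1 h0
    refine ⟨_, ?_, (add_sub_cancel _ _).symm⟩
    have h2 := congrArg norm h1
    rw [norm_mul, norm_mul, norm_phase, hz, one_mul, one_mul] at h2
    have hn : ((‖g (M.X 0 ω)‖ : ℝ) : ℂ) ≠ 0 := by
      exact_mod_cast norm_ne_zero_iff.2 h0
    have h3 := Complex.norm_mul_exp_arg_mul_I z
    rw [hz, Complex.ofReal_one, one_mul] at h3
    rw [← Complex.norm_mul_exp_arg_mul_I (g (M.X 1 ω)),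
      ← Complex.norm_mul_exp_arg_mul_I (g (M.X 0 ω)), h2, mul_left_comm, mul_left_comm z] at h1
    have h4 := mul_left_cancel₀ hn h1
    rw [mem_characterKernel, ← pathIntegral_self, inner_sub_right, inner_sub_right,
      inner_add_right, inner_div_smul ht, inner_div_smul ht, inner_div_smul ht]
    push_cast
    rw [sub_mul, sub_mul, add_mul, Complex.exp_sub, Complex.exp_sub, Complex.exp_add,
      ← phase_eq, h4, h3, mul_div_assoc, div_self (Complex.exp_ne_zero _), mul_one, div_self]
    rw [← norm_ne_zero_iff, hz]
    exact one_ne_zero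

theorem NonLatticeCond.nonArithmetic (hM : Mixing M ν) (hnl : NonLatticeCond M ν b) :
    NonArithmetic M b := by
  intro α t ht
  by_contra hr
  have hinv := hM.1.1
  have := hinv.1
  obtain ⟨N, δ, hδ0, hδ⟩ := hM.exists_nat
  have : Nontrivial (BM E) := by
    obtain ⟨x⟩ : Nonempty E := nonempty_of_isProbabilityMeasure ν
    refine ⟨⟨0, BM.mk (fun _ => 1) measurable_const 1 (by simp), fun h => ?_⟩⟩
    exact zero_ne_one (congrArg (fun f : BM E => f.toFun x) h)
  obtain ⟨z, hz, f, hf1, hf⟩ :=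
    exists_approx_eigenvector (Q M b t α α) (norm_Q_le t α) (not_lt.1 hr)
  -- Injectivity of the difference operator is where the non-lattice condition enters.
  refine not_tendsto_inner_zero b hδ0 hδ t α hz hf1 hf fun g =>
    tendsto_inner_of_injective
      (twistL2 b hinv t α - z • (evalL2 hinv 0).toContinuousLinearMap)
      (fun g hg => ?_) (fun n => (norm_toL2_le ν (f n)).trans (hf1 n).le) ?_ g
  · have h1 : twistL2 b hinv t α g = z • evalL2 hinv 0 g := sub_eq_zero.1 hg
    refine (Lp.eq_zero_iff_ae_eq_zero).2
      (hnl.ae_eq_zero hM ht α hz (Lp.stronglyMeasurable g).measurable ?_)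
    filter_upwards [coeFn_twistL2 b hinv t α g, coeFn_evalL2 hinv 0 g,
      Lp.coeFn_smul z (evalL2 hinv 0 g)] with ω h2 h3 h4
    rw [← h2, h1, h4, Pi.smul_apply, h3, smul_eq_mul]
  · have h2 : Tendsto (fun n => √(2 * (‖f n‖ * ‖Q M b t α α (f n) - z • f n‖))) atTop (𝓝 0) := by
      simp only [hf1, one_mul]
      simpa using (hf.const_mul 2).sqrt
    exact squeeze_zero (fun _ => norm_nonneg _)
      (fun n => Real.le_sqrt_of_sq_le (norm_twistL2_sub_sq_le b hinv t α hz (f n))) h2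

end NonArithmetic

end NonLattice

end

theorem mainTheorem7 {E Ω : Type*} [MetricSpace E] [CompleteSpace E]
    [TopologicalSpace.SeparableSpace E] [MeasurableSpace E] [BorelSpace E] [MeasurableSpace Ω]
    (M : NonLattice.MarkovFamily E Ω) (ν : Measure E) (hν : NonLattice.Mixing M ν)
    {d : ℕ} (b : (unitInterval × E) →ᵇ NonLattice.Vec d) (hb : NonLattice.CenteredSmooth ν b) :
    NonLattice.NonArithmetic M b ↔ NonLattice.NonLatticeCond M ν b :=
  ⟨fun h => h.nonLatticeCond hν.1.1, fun h => h.nonArithmetic hν⟩
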